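/- **Setting.** All spaces are diffeological. The internal tangent space $T_xX$ is the colimit of the vector spaces $T_0U$ over all plots $p\colon U\to X$ with $0\in U$, $p(0)=x$ (arrows: smooth maps over $X$ fixing $0$), and $TX=\bigsqcup_x T_xX$ has the smallest diffeology for which $TX\to X$ is a vector pseudo-bundle and $Tp\colon TU\to TX$ is smooth for every plot $p$. A diffeological group $G$ is a *diffeological Lie group* if for each nonzero $\xi\in T_eG$ there is a smooth linear functional on $T_eG$ not vanishing at $\xi$, and the plots of $T_eG$ factor smoothly through a smooth map $V\to T_eG$, where $V$ is an open subset of a complete Hausdorff locally convex space. It is *regular* if there is a smooth map $\exp\colon C^\infty([0,1],T_eG)\to C^\infty([0,1],G)$ such that $g=\exp(\xi)$ is the unique solution of $g(0)=e$, $(R_{g(t)^{-1}})_*\dot g(t)=\xi(t)$ for $0<t<1$. A *principal $G$-bundle* is a smooth surjection $\pi\colon E\to X$ with a smooth (left) action of $G$ on $E$ such that the pullback of $E$ by every plot $p\colon U\to X$ is locally equivariantly trivial, that is, each $u\in U$ has an open neighbourhood $V$ and a smooth lift $q\colon V\to E$ of $p|_V$ for which $(v,g)\mapsto (v,g\cdot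 q(v))$ is a diffeomorphism $V\times G\to (p|_V)^*E$. A *connection $1$-form* is a smooth, fibrewise linear, $G$-equivariant map $\omega\colon TE\to T_eG$ (for the adjoint action on $T_eG$) such that $\omega\big(\tfrac{d}{dt}\big|_{0}\,c(t)\cdot y\big)=\dot c(0)$ for all $y\in E$ and all smooth curves $c$ in $G$ with $c(0)=e$. $\mathrm{Paths}_{\mathrm{loc}}(E)$ is the space of smooth maps from nonempty open intervals of $\mathbb R$ to $E$, with the standard functional diffeology for maps with varying domains, and $\mathrm{tbPaths}_{\mathrm{loc}}(E)=\{(\gamma,t): t\in\mathrm{dom}\,\gamma\}\subseteq \mathrm{Paths}_{\mathrm{loc}}(E)\times\mathbb R$ has the subset diffeology. A *diffeological connection* on $\pi$ is a smooth map $\theta\colon\mathrm{tbPaths}_{\mathrm{loc}}(E)\to\mathrm{Paths}_{\mathrm{loc}}(E)$ such that for all $(\gamma,t_0)$: (1) $\mathrm{dom}\,\theta(\gamma,t_0)=\mathrm{dom}\,\gamma$; (2) $\pi\circ\theta(\gamma,t_0)=\pi\circ\gamma$; (3) $\theta(\gamma,t_0)(t_0)=\gamma(t_0)$; (4) $\theta(g\cdot\gamma,t_0)=g\cdot\theta(\gamma,t_0)$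 for $g\in G$; (5) $\theta(\gamma\circ f,s)=\theta(\gamma,f(s))\circ f$ for every smooth map $f$ from an open interval containing $s$ to $\mathrm{dom}\,\gamma$; (6) $\theta(\theta(\gamma,t_0),t_0)=\theta(\gamma,t_0)$. **Proposition.** Let $G$ be a regular diffeological Lie group, $\pi\colon E\to X$ a principal $G$-bundle, and $\omega$ a connection $1$-form on $E$. Then $\omega$ induces a diffeological connection $\theta$ on $\pi$. More precisely, for every $(\gamma,t_0)\in\mathrm{tbPaths}_{\mathrm{loc}}(E)$ there is a unique smooth $g\colon\mathrm{dom}\,\gamma\to G$ with $g(t_0)=e$ and $$\omega\Big(\frac{d}{dt}\big(g(t)\cdot\gamma(t)\big)\Big)=0\quad\text{for all } t\in\mathrm{dom}\,\gamma;$$ it satisfies the gauge equation $\omega(\dot\gamma(t))=-\mathrm{Ad}_{g(t)^{-1}}\big((R_{g(t)^{-1}})_*\dot g(t)\big)$; and $\theta(\gamma,t_0)(t):=g(t)\cdot\gamma(t)$ defines a diffeological connection on $\pi$ (in particular a smooth map $\mathrm{tbPaths}_{\mathrm{loc}}(E)\to\mathrm{Paths}_{\mathrm{loc}}(E)$). 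-/

import Mathlib

noncomputable section

namespace Diffeology

open scoped ContDiff

universe u v w

/-- The Euclidean space `ℝⁿ`. -/
abbrev Eucl (n : ℕ) : Type := EuclideanSpace ℝ (Fin n)

/-! ### Subspaces, products, function spaces -/

/-- The pullback diffeology along `f`: plots are the maps whose composite with `f` is a plot. -/
@[reducible]
def inducedDiffeology {X : Type u} {Y : Type v} (f : X → Y) [DiffeologicalSpace Y] :
    DiffeologicalSpace X where
  plots _ := {p | IsPlot (f ∘ p)}
  constant_plots x := isPlot_const (x := f x)
  plot_reparam hp hf := isPlot_reparam hp hf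
  locality {n p} hp := DiffeologicalSpace.locality (p := f ∘ p) fun x ↦ by
    obtain ⟨s, hs, hxs, h⟩ := hp x
    exact ⟨s, hs, hxs, fun hfs hf ↦ h hfs hf⟩

/-- Subsets carry the subset diffeology. -/
instance instSubtype {X : Type u} [DiffeologicalSpace X] (P : X → Prop) :
    DiffeologicalSpace {x : X // P x} :=
  inducedDiffeology Subtype.val

/-- Products carry the product diffeology. -/
instance instProd {X : Type u} {Y : Type v} [DiffeologicalSpace X] [DiffeologicalSpace Y] :
    DiffeologicalSpace (X × Y) where
  plots _ := {p | IsPlot (fun a ↦ (p a).1) ∧ IsPlot (fun a ↦ (p a).2)}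
  constant_plots x := ⟨isPlot_const (x := x.1), isPlot_const (x := x.2)⟩
  plot_reparam hp hf := ⟨isPlot_reparam hp.1 hf, isPlot_reparam hp.2 hf⟩
  locality {n p} hp := by
    constructor
    · refine DiffeologicalSpace.locality fun x ↦ ?_
      obtain ⟨s, hs, hxs, h⟩ := hp x
      exact ⟨s, hs, hxs, fun hfs hf ↦ (h hfs hf).1⟩
    · refine DiffeologicalSpace.locality fun x ↦ ?_
      obtain ⟨s, hs, hxs, h⟩ := hp x
      exact ⟨s, hs, hxs, fun hfs hf ↦ (h hfs hf).2⟩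

theorem dSmooth_subtype_val {X : Type u} [DiffeologicalSpace X] (P : X → Prop) :
    DSmooth (Subtype.val : {x : X // P x} → X) :=
  fun _ _ hp ↦ hp

theorem DSmooth.subtype_mk {X : Type u} {Y : Type v} [DiffeologicalSpace X]
    [DiffeologicalSpace Y] {P : Y → Prop} {f : X → Y} (hf : DSmooth f) (h : ∀ x, P (f x)) :
    DSmooth (fun x ↦ (⟨f x, h x⟩ : {y : Y // P y})) :=
  fun n p hp ↦ hf n p hp

theorem DSmooth.prodMk {X : Type u} {Y : Type v} {Z : Type w} [DiffeologicalSpace X]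
    [DiffeologicalSpace Y] [DiffeologicalSpace Z] {f : X → Y} {g : X → Z}
    (hf : DSmooth f) (hg : DSmooth g) : DSmooth (fun x ↦ (f x, g x)) :=
  fun n p hp ↦ ⟨hf n p hp, hg n p hp⟩

/-- `f` is a diffeomorphism. -/
def IsDiffeomorphism {X : Type u} {Y : Type v} [DiffeologicalSpace X] [DiffeologicalSpace Y]
    (f : X → Y) : Prop :=
  DSmooth f ∧ ∃ g : Y → X, DSmooth g ∧ Function.LeftInverse g f ∧ Function.RightInverse g f

/-- The set `C^∞(X, Y)` of smooth maps. -/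
@[ext]
structure SmoothMap (X : Type u) (Y : Type v) [DiffeologicalSpace X] [DiffeologicalSpace Y] where
  toFun : X → Y
  smooth : DSmooth toFun

instance {X : Type u} {Y : Type v} [DiffeologicalSpace X] [DiffeologicalSpace Y] :
    CoeFun (SmoothMap X Y) (fun _ ↦ X → Y) :=
  ⟨SmoothMap.toFun⟩

/-- The standard functional diffeology on `C^∞(X, Y)`: a parametrisation `p` is a plot if and
only if `(a, x) ↦ p a x` is smooth. -/
instance instSmoothMap {X : Type u} {Y : Type v} [DiffeologicalSpace X] [DiffeologicalSpace Y] :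
    DiffeologicalSpace (SmoothMap X Y) where
  plots n := {p | DSmooth (fun z : Eucl n × X ↦ p z.1 z.2)}
  constant_plots f := fun m q hq ↦ f.smooth m _ hq.2
  plot_reparam {n m p f} hp hf := fun k q hq ↦
    hp k (fun a ↦ (f (q a).1, (q a).2)) ⟨(hf.comp hq.1.contDiff).isPlot, hq.2⟩
  locality {n p} hp := by
    intro m q hq
    refine DiffeologicalSpace.locality fun x ↦ ?_
    obtain ⟨s, hs, hxs, h⟩ := hp (q x).1
    have hq1 : ContDiff ℝ ∞ (fun a ↦ (q a).1) := IsPlot.contDiff hq.1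
    refine ⟨(fun a ↦ (q a).1) ⁻¹' s, hs.preimage hq1.continuous, hxs, ?_⟩
    intro k f hfs hf
    have := h (f := fun a ↦ (q (f a)).1) (fun a ↦ hfs a) (hq1.comp hf)
    exact this k (fun a ↦ (a, (q (f a)).2)) ⟨isPlot_id, isPlot_reparam hq.2 hf⟩

/-! ### The internal tangent bundle -/

/-- A plot `p : U → X` with `U` an open neighbourhood of `0` and `p 0 = x`.
(Connectedness of `U` is not imposed: the restriction of `p` to a ball around `0` is an arrow
that induces the identity on the tangent space at `0`, so the colimit below is the same.) -/
structure PointedPlot {X : Type u} [DiffeologicalSpace X] (x : X) where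
  dim : ℕ
  dom : Set (Eucl dim)
  isOpen : IsOpen dom
  zero_mem : (0 : Eucl dim) ∈ dom
  toFun : dom → X
  smooth : DSmooth toFun
  map_zero : toFun ⟨0, zero_mem⟩ = x

/-- `f` is an arrow from `p : U → X` to `q : V → X`: a smooth map `U → V` with `f 0 = 0` and
`q ∘ f = p`. (Only the values of `f` on `U` matter.) -/
structure PointedPlot.IsArrow {X : Type u} [DiffeologicalSpace X] {x : X} (p q : PointedPlot x)
    (f : Eucl p.dim → Eucl q.dim) : Prop where
  contDiffOn : ContDiffOn ℝ ∞ f p.dom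
  map_zero : f 0 = 0
  mapsTo : Set.MapsTo f p.dom q.dom
  comp_eq : ∀ a : p.dom, q.toFun ⟨f a, mapsTo a.2⟩ = p.toFun a

open Classical in
/-- The relations `(p, v) ~ (q, f_* v)`, for all arrows `f` from `p` to `q`. -/
def tangentRelations {X : Type u} [DiffeologicalSpace X] (x : X) :
    Submodule ℝ (DirectSum (PointedPlot x) fun p ↦ Eucl p.dim) :=
  Submodule.span ℝ
    {z | ∃ (p q : PointedPlot x) (f : Eucl p.dim → Eucl q.dim) (v : Eucl p.dim),
      p.IsArrow q f ∧
      z = DirectSum.lof ℝ (PointedPlot x) (fun p ↦ Eucl p.dim) p v -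
        DirectSum.lof ℝ (PointedPlot x) (fun p ↦ Eucl p.dim) q (fderiv ℝ f 0 v)}

/-- The internal tangent space `T_x X`: the colimit, over the category of pointed plots at `x`,
of the tangent spaces at `0` of their domains. -/
def InternalTangentSpace {X : Type u} [DiffeologicalSpace X] (x : X) : Type u :=
  (DirectSum (PointedPlot x) fun p ↦ Eucl p.dim) ⧸ tangentRelations x

instance {X : Type u} [DiffeologicalSpace X] (x : X) : AddCommGroup (InternalTangentSpace x) :=
  inferInstanceAs (AddCommGroup (_ ⧸ tangentRelations x))

instance {X : Type u} [DiffeologicalSpace X] (x : X) : Module ℝ (InternalTangentSpace x) :=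
  inferInstanceAs (Module ℝ (_ ⧸ tangentRelations x))

open Classical in
/-- The structure map `p_* : T_0 U → T_x X` of the colimit. -/
def PointedPlot.pushforward {X : Type u} [DiffeologicalSpace X] {x : X} (p : PointedPlot x) :
    Eucl p.dim →ₗ[ℝ] InternalTangentSpace x :=
  (tangentRelations x).mkQ ∘ₗ DirectSum.lof ℝ (PointedPlot x) (fun p ↦ Eucl p.dim) p

theorem PointedPlot.IsArrow.pushforward_eq {X : Type u} [DiffeologicalSpace X] {x : X}
    {p q : PointedPlot x} {f : Eucl p.dim → Eucl q.dim} (h : p.IsArrow q f) (v : Eucl p.dim) :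
    p.pushforward v = q.pushforward (fderiv ℝ f 0 v) := by
  refine (Submodule.Quotient.eq (tangentRelations x)).2 (Submodule.subset_span ?_)
  exact ⟨p, q, f, v, h, rfl⟩

/-- The pointed plot `f ∘ p`. -/
def PointedPlot.postcomp {X : Type u} {Y : Type v} [DiffeologicalSpace X] [DiffeologicalSpace Y]
    {x : X} {y : Y} (p : PointedPlot x) (f : X → Y) (hf : DSmooth f) (h : f x = y) :
    PointedPlot y where
  dim := p.dim
  dom := p.dom
  isOpen := p.isOpen
  zero_mem := p.zero_mem
  toFun := f ∘ p.toFun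
  smooth := hf.comp p.smooth
  map_zero := by simp [p.map_zero, h]

open Classical in
/-- The tangent map `f_* : T_x X → T_y Y` of a smooth map `f` with `f x = y`. It sends `p_* v` to
`(f ∘ p)_* v`. -/
def InternalTangentSpace.map {X : Type u} {Y : Type v} [DiffeologicalSpace X]
    [DiffeologicalSpace Y] {x : X} {y : Y} (f : X → Y) (hf : DSmooth f) (h : f x = y) :
    InternalTangentSpace x →ₗ[ℝ] InternalTangentSpace y :=
  (tangentRelations x).liftQ
    (DirectSum.toModule ℝ (PointedPlot x) (InternalTangentSpace y)
      fun p ↦ (p.postcomp f hf h).pushforward) (by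
    refine Submodule.span_le.2 ?_
    rintro _ ⟨p, q, g, v, hg, rfl⟩
    have hg' : (p.postcomp f hf h).IsArrow (q.postcomp f hf h) g :=
      ⟨hg.contDiffOn, hg.map_zero, hg.mapsTo, fun a ↦ congrArg f (hg.comp_eq a)⟩
    rw [SetLike.mem_coe, LinearMap.mem_ker, map_sub, sub_eq_zero]
    refine (DirectSum.toModule_lof ℝ (M := fun p : PointedPlot x ↦ Eucl p.dim) p v).trans
      (Eq.trans ?_ (DirectSum.toModule_lof ℝ (M := fun p : PointedPlot x ↦ Eucl p.dim) q
        (fderiv ℝ g 0 v)).symm)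
    exact hg'.pushforward_eq v)

/-- The total space `TX`, the disjoint union of the internal tangent spaces. -/
structure InternalTangentBundle (X : Type u) [DiffeologicalSpace X] : Type u where
  pt : X
  vec : InternalTangentSpace pt

/-- For a plot `p : U → X` and `a ∈ U`, the pointed plot `b ↦ p (a + b)` at `p a`. -/
def translatedPlot {X : Type u} [DiffeologicalSpace X] {n : ℕ} {U : Set (Eucl n)}
    (hU : IsOpen U) (p : U → X) (hp : DSmooth p) (a : U) : PointedPlot (p a) where
  dim := n
  dom := {b | (a : Eucl n) + b ∈ U}
  isOpen := hU.preimage (continuous_const.add continuous_id)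
  zero_mem := by simp
  toFun b := p ⟨(a : Eucl n) + b, b.2⟩
  smooth := by
    refine hp.comp (DSmooth.subtype_mk ?_ _)
    exact (ContDiff.dSmooth (f := fun b : Eucl n ↦ (a : Eucl n) + b)
      (contDiff_const.add contDiff_id)).comp (dSmooth_subtype_val _)
  map_zero := by simp

/-- The tangent map `Tp : TU = U × ℝⁿ → TX` of a plot `p : U → X`. -/
def plotTangentMap {X : Type u} [DiffeologicalSpace X] {n : ℕ} {U : Set (Eucl n)}
    (hU : IsOpen U) (p : U → X) (hp : DSmooth p) (z : U × Eucl n) : InternalTangentBundle X :=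
  ⟨p z.1, (translatedPlot hU p hp z.1).pushforward z.2⟩

/-- The diffeologies on `TX` for which `TX → X` is a vector pseudo-bundle (the first four fields;
they make each fibre a diffeological vector space) and all the maps `Tp` are smooth. -/
structure IsTangentDiffeology {X : Type u} [DiffeologicalSpace X]
    (d : DiffeologicalSpace (InternalTangentBundle X)) : Prop where
  smooth_proj : DSmooth (fun z : InternalTangentBundle X ↦ z.pt)
  smooth_zero : DSmooth (fun x : X ↦ (⟨x, 0⟩ : InternalTangentBundle X))
  smooth_add : DSmooth
    (fun z : {z : InternalTangentBundle X × InternalTangentBundle X // z.1.pt = z.2.pt} ↦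
      (⟨z.1.2.pt, (z.2 ▸ z.1.1.vec) + z.1.2.vec⟩ : InternalTangentBundle X))
  smooth_smul : DSmooth (fun z : ℝ × InternalTangentBundle X ↦
    (⟨z.2.pt, z.1 • z.2.vec⟩ : InternalTangentBundle X))
  smooth_plot : ∀ (n : ℕ) (U : Set (Eucl n)) (hU : IsOpen U) (p : U → X) (hp : DSmooth p),
    DSmooth (plotTangentMap hU p hp)

/-- The diffeology of the internal tangent bundle: the smallest one (that is, the intersection of
all those) with the properties in `IsTangentDiffeology`. -/
instance instTangentBundle (X : Type u) [DiffeologicalSpace X] :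
    DiffeologicalSpace (InternalTangentBundle X) :=
  sInf {d | IsTangentDiffeology d}

/-- `T_x X` carries the subset diffeology of `TX`. -/
instance instTangentSpace {X : Type u} [DiffeologicalSpace X] (x : X) :
    DiffeologicalSpace (InternalTangentSpace x) :=
  inducedDiffeology (fun v ↦ (⟨x, v⟩ : InternalTangentBundle X))

/-! ### Curves -/

/-- For a smooth curve `c : S → X`, `S ⊆ ℝ`, and an interior point `t` of `S` with `c t = x`, the
pointed plot `s ↦ c (t + s)` at `x`. -/
def velocityPlot {X : Type u} [DiffeologicalSpace X] {S : Set ℝ} (c : SmoothMap S X) (t : S)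
    (ht : (t : ℝ) ∈ interior S) {x : X} (h : c t = x) : PointedPlot x where
  dim := 1
  dom := {s | (t : ℝ) + s 0 ∈ interior S}
  isOpen := isOpen_interior.preimage (by fun_prop)
  zero_mem := by simpa using ht
  toFun s := c ⟨(t : ℝ) + s.1 0, interior_subset s.2⟩
  smooth := by
    refine c.smooth.comp (DSmooth.subtype_mk ?_ _)
    exact (ContDiff.dSmooth (f := fun s : Eucl 1 ↦ (t : ℝ) + s 0) (by fun_prop)).comp
      (dSmooth_subtype_val _)
  map_zero := by simpa using h

/-- The velocity `dc/dt ∈ T_x X` of a smooth curve `c : S → X` at an interior point `t` of `S`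
with `c t = x`. -/
def velocity {X : Type u} [DiffeologicalSpace X] {S : Set ℝ} (c : SmoothMap S X) (t : S)
    (ht : (t : ℝ) ∈ interior S) {x : X} (h : c t = x) : InternalTangentSpace x :=
  (velocityPlot c t ht h).pushforward (EuclideanSpace.single (0 : Fin 1) (1 : ℝ))

/-- A local path in `X`: a smooth map from a nonempty open interval of `ℝ` (bounded or not)
to `X`. -/
structure LocalPath (X : Type u) [DiffeologicalSpace X] where
  dom : Set ℝ
  isOpen : IsOpen dom
  ordConnected : dom.OrdConnected
  nonempty : dom.Nonempty
  curve : SmoothMap dom X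

namespace LocalPath

/-- The standard functional diffeology on local paths: `p` is a plot if and only if for all `a`
and all `t` in the domain of `p a` there are open neighbourhoods `A` of `a` and `B` of `t` such
that `B ⊆ dom (p a')` for all `a' ∈ A` and `(a', t') ↦ p a' t'` is smooth on `A × B`. -/
instance instDiffeologicalSpace {X : Type u} [DiffeologicalSpace X] :
    DiffeologicalSpace (LocalPath X) :=
  .ofCorePlotsOn {
    isPlotOn := fun {n U} _ p ↦ ∀ a ∈ U, ∀ t ∈ (p a).dom,
      ∃ (A : Set (Eucl n)) (B : Set ℝ), IsOpen A ∧ a ∈ A ∧ A ⊆ U ∧ IsOpen B ∧ t ∈ B ∧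
        ∃ h : ∀ a' ∈ A, B ⊆ (p a').dom,
          DSmooth (fun z : A × B ↦ (p z.1).curve ⟨z.2, h z.1 z.1.2 z.2.2⟩)
    isPlotOn_congr := by
      have key : ∀ {n : ℕ} {U : Set (Eucl n)} {p q : Eucl n → LocalPath X}, Set.EqOn p q U →
          (∀ a ∈ U, ∀ t ∈ (p a).dom,
            ∃ (A : Set (Eucl n)) (B : Set ℝ), IsOpen A ∧ a ∈ A ∧ A ⊆ U ∧ IsOpen B ∧ t ∈ B ∧
              ∃ h : ∀ a' ∈ A, B ⊆ (p a').dom,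
                DSmooth (fun z : A × B ↦ (p z.1).curve ⟨z.2, h z.1 z.1.2 z.2.2⟩)) →
          (∀ a ∈ U, ∀ t ∈ (q a).dom,
            ∃ (A : Set (Eucl n)) (B : Set ℝ), IsOpen A ∧ a ∈ A ∧ A ⊆ U ∧ IsOpen B ∧ t ∈ B ∧
              ∃ h : ∀ a' ∈ A, B ⊆ (q a').dom,
                DSmooth (fun z : A × B ↦ (q z.1).curve ⟨z.2, h z.1 z.1.2 z.2.2⟩)) := by
        intro n U p q hpq H a ha t ht
        obtain ⟨A, B, hA, haA, hAU, hB, htB, h, hs⟩ := H a ha t (by rw [hpq ha]; exact ht)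
        have h' : ∀ a' ∈ A, B ⊆ (q a').dom := fun a' ha' ↦ by
          rw [← hpq (hAU ha')]; exact h a' ha'
        refine ⟨A, B, hA, haA, hAU, hB, htB, h', ?_⟩
        have hz : ∀ (γ δ : LocalPath X) (s : ℝ) (h₁ : s ∈ γ.dom) (h₂ : s ∈ δ.dom), γ = δ →
            γ.curve ⟨s, h₁⟩ = δ.curve ⟨s, h₂⟩ := by
          rintro γ _ s h₁ h₂ rfl
          rfl
        have : (fun z : A × B ↦ (q z.1).curve ⟨z.2, h' z.1 z.1.2 z.2.2⟩) =
            fun z : A × B ↦ (p z.1).curve ⟨z.2, h z.1 z.1.2 z.2.2⟩ :=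
          funext fun z ↦ hz _ _ _ _ _ (hpq (hAU z.1.2)).symm
        rw [this]
        exact hs
      intro _ _ _ _ _ h
      exact ⟨key h, key h.symm⟩
    isPlot_const := fun {n} γ a _ t ht ↦
      ⟨Set.univ, γ.dom, isOpen_univ, trivial, subset_rfl, γ.isOpen, ht, fun _ _ ↦ subset_rfl,
        fun m q hq ↦ γ.curve.smooth m _ hq.2⟩
    isPlotOn_reparam := by
      intro n m U V hU hV p f hf H hfs a ha t ht
      obtain ⟨A, B, hA, haA, hAU, hB, htB, h, hs⟩ := H (f a) (hf ha) t ht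
      refine ⟨V ∩ f ⁻¹' A, B, hfs.continuousOn.isOpen_inter_preimage hV hA, ⟨ha, haA⟩,
        Set.inter_subset_left, hB, htB, fun a' ha' ↦ h (f a') ha'.2, ?_⟩
      intro k q hq
      refine hs k (fun b ↦ (⟨f (q b).1, (q b).1.2.2⟩, (q b).2)) ⟨?_, hq.2⟩
      have hq1 : ContDiff ℝ ∞ (fun b ↦ ((q b).1 : Eucl m)) := IsPlot.contDiff hq.1
      exact (hfs.comp_contDiff hq1 fun b ↦ (q b).1.2.1).isPlot (X := Eucl n)
    locality := by
      intro n U hU p H a ha t ht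
      obtain ⟨V, hV, haV, HV⟩ := H a ha
      obtain ⟨A, B, hA, haA, hAV, hB, htB, h, hs⟩ := HV a haV t ht
      refine ⟨A ∩ U, B, hA.inter hU, ⟨haA, ha⟩, Set.inter_subset_right, hB, htB,
        fun a' ha' ↦ h a' ha'.1, ?_⟩
      intro k q hq
      exact hs k (fun b ↦ (⟨(q b).1, (q b).1.2.1⟩, (q b).2)) hq }

/-- The velocity of a local path. -/
def velocity {X : Type u} [DiffeologicalSpace X] (γ : LocalPath X) (t : γ.dom) :
    InternalTangentSpace (γ.curve t) :=
  Diffeology.velocity γ.curve t (by rw [γ.isOpen.interior_eq]; exact t.2) rfl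

/-- The local path `γ ∘ f`, for a smooth map `f` from an open interval to the domain of `γ`. -/
def comp {X : Type u} [DiffeologicalSpace X] (γ : LocalPath X) (f : LocalPath ℝ)
    (hf : ∀ t, f.curve t ∈ γ.dom) : LocalPath X where
  dom := f.dom
  isOpen := f.isOpen
  ordConnected := f.ordConnected
  nonempty := f.nonempty
  curve := ⟨fun t ↦ γ.curve ⟨f.curve t, hf t⟩,
    γ.curve.smooth.comp (DSmooth.subtype_mk f.curve.smooth hf)⟩

end LocalPath

/-- The tautological bundle of local paths `{(γ, t) | t ∈ dom γ}`, with the subset diffeology of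
the product. -/
abbrev TbLocalPath (X : Type u) [DiffeologicalSpace X] : Type u :=
  {z : LocalPath X × ℝ // z.2 ∈ z.1.dom}

/-! ### Diffeological groups and regularity -/

/-- A diffeological group. -/
class DiffeologicalGroup (G : Type u) [Group G] [DiffeologicalSpace G] : Prop where
  smooth_mul : DSmooth (fun z : G × G ↦ z.1 * z.2)
  smooth_inv : DSmooth (fun g : G ↦ g⁻¹)

/-- A smooth action of a diffeological group. -/
class DiffeologicalAction (G : Type u) (E : Type v) [Group G] [DiffeologicalSpace G]
    [DiffeologicalSpace E] [MulAction G E] : Prop where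
  smooth_smul : DSmooth (fun z : G × E ↦ z.1 • z.2)

theorem dSmooth_mul_right {G : Type u} [Group G] [DiffeologicalSpace G] [DiffeologicalGroup G]
    (a : G) : DSmooth (fun g : G ↦ g * a) :=
  DiffeologicalGroup.smooth_mul.comp (DSmooth.prodMk dSmooth_id dSmooth_const)

theorem dSmooth_conj {G : Type u} [Group G] [DiffeologicalSpace G] [DiffeologicalGroup G]
    (a : G) : DSmooth (fun g : G ↦ a * g * a⁻¹) :=
  (dSmooth_mul_right a⁻¹).comp
    (DiffeologicalGroup.smooth_mul.comp (DSmooth.prodMk dSmooth_const dSmooth_id))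

theorem dSmooth_smul {G : Type u} {E : Type v} [Group G] [DiffeologicalSpace G]
    [DiffeologicalSpace E] [MulAction G E] [DiffeologicalAction G E] (g : G) :
    DSmooth (fun y : E ↦ g • y) :=
  DiffeologicalAction.smooth_smul.comp (DSmooth.prodMk dSmooth_const dSmooth_id)

/-- The adjoint action `Ad_g : T_e G → T_e G`, the tangent map of `h ↦ g h g⁻¹`. -/
def Ad {G : Type u} [Group G] [DiffeologicalSpace G] [DiffeologicalGroup G] (g : G) :
    InternalTangentSpace (1 : G) →ₗ[ℝ] InternalTangentSpace (1 : G) :=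
  InternalTangentSpace.map (fun h ↦ g * h * g⁻¹) (dSmooth_conj g) (by simp)

/-- The right logarithmic derivative `(R_{c(t)⁻¹})_* (dc/dt) ∈ T_e G` of a smooth curve in `G` at
an interior point `t` of its domain. -/
def rightLogDeriv {G : Type u} [Group G] [DiffeologicalSpace G] [DiffeologicalGroup G]
    {S : Set ℝ} (c : SmoothMap S G) (t : S) (ht : (t : ℝ) ∈ interior S) :
    InternalTangentSpace (1 : G) :=
  InternalTangentSpace.map (fun h ↦ h * (c t)⁻¹) (dSmooth_mul_right _) (mul_inv_cancel (c t))
    (velocity c t ht rfl)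

/-- `C^k` maps from `ℝⁿ` to a topological vector space: all iterated partial derivatives up to
order `k` exist and are continuous. -/
def IsCk {n : ℕ} {W : Type u} [AddCommGroup W] [Module ℝ W] [TopologicalSpace W] :
    ℕ → (Eucl n → W) → Prop
  | 0, q => Continuous q
  | k + 1, q => Continuous q ∧ ∃ q' : Fin n → Eucl n → W, (∀ i, IsCk k (q' i)) ∧
      ∀ (i : Fin n) (a : Eucl n), Filter.Tendsto
        (fun s : ℝ ↦ s⁻¹ • (q (a + s • EuclideanSpace.single i 1) - q a))
        (nhdsWithin 0 {0}ᶜ) (nhds (q' i a))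

/-- A diffeological Lie group: smooth linear functionals separate the points of `T_e G` from `0`,
and the plots of `T_e G` factor smoothly through a smooth map `φ : V → T_e G` on an open subset
`V` of a complete Hausdorff locally convex topological vector space `W`. -/
structure IsDiffeologicalLieGroup (G : Type u) [Group G] [DiffeologicalSpace G]
    [DiffeologicalGroup G] : Prop where
  separating : ∀ ξ : InternalTangentSpace (1 : G), ξ ≠ 0 →
    ∃ l : InternalTangentSpace (1 : G) →ₗ[ℝ] ℝ, DSmooth l ∧ l ξ ≠ 0
  factorization : ∃ (W : Type u) (_ : AddCommGroup W) (_ : Module ℝ W) (_ : UniformSpace W)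
    (_ : IsUniformAddGroup W) (_ : ContinuousSMul ℝ W) (_ : LocallyConvexSpace ℝ W)
    (_ : CompleteSpace W) (_ : T2Space W) (V : Set W) (φ : V → InternalTangentSpace (1 : G)),
    IsOpen V ∧
    (∀ (n : ℕ) (q : Eucl n → V), (∀ k, IsCk k (fun a ↦ (q a : W))) → IsPlot (φ ∘ q)) ∧
    ∀ (n : ℕ) (p : Eucl n → InternalTangentSpace (1 : G)), IsPlot p →
      ∃ q : Eucl n → V, (∀ k, IsCk k (fun a ↦ (q a : W))) ∧ p = φ ∘ q

/-- `g : [0,1] → G` solves `g(0) = e`, `(R_{g(t)⁻¹})_* (dg/dt) = ξ(t)`. -/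
def IsLogSolution {G : Type u} [Group G] [DiffeologicalSpace G] [DiffeologicalGroup G]
    (ξ : SmoothMap (Set.Icc (0 : ℝ) 1) (InternalTangentSpace (1 : G)))
    (g : SmoothMap (Set.Icc (0 : ℝ) 1) G) : Prop :=
  g ⟨0, by simp⟩ = 1 ∧
    ∀ (t : Set.Icc (0 : ℝ) 1) (ht : (t : ℝ) ∈ interior (Set.Icc (0 : ℝ) 1)),
      rightLogDeriv g t ht = ξ t

/-- A regular diffeological Lie group: there is a smooth map
`exp : C^∞([0,1], T_e G) → C^∞([0,1], G)` such that `exp ξ` is the unique solution of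
`g(0) = e`, `(R_{g(t)⁻¹})_* (dg/dt) = ξ(t)`. -/
structure IsRegularLieGroup (G : Type u) [Group G] [DiffeologicalSpace G]
    [DiffeologicalGroup G] : Prop where
  isLie : IsDiffeologicalLieGroup G
  exists_exp : ∃ exp : SmoothMap (Set.Icc (0 : ℝ) 1) (InternalTangentSpace (1 : G)) →
      SmoothMap (Set.Icc (0 : ℝ) 1) G,
    DSmooth exp ∧ ∀ ξ, IsLogSolution ξ (exp ξ) ∧ ∀ g, IsLogSolution ξ g → g = exp ξ

/-! ### Principal bundles and connections -/

section Bundles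

variable (G : Type u) {E : Type v} {X : Type w} [Group G] [DiffeologicalSpace G]
  [DiffeologicalSpace E] [DiffeologicalSpace X] [MulAction G E]

/-- A principal `G`-bundle: a smooth surjection `π : E → X`, with a smooth action of `G` on `E`,
such that for every plot `p` of `X` the pullback bundle `p^* E` is locally equivariantly trivial,
by maps `V × G → p|_V^* E`, `(a, g) ↦ (a, g • q a)`, with `q` a lift of `p|_V` to `E`. -/
structure IsPrincipalBundle [DiffeologicalAction G E] (π : E → X) : Prop where
  smooth_proj : DSmooth π
  surjective : Function.Surjective π
  locally_trivial : ∀ (n : ℕ) (p : Eucl n → X), IsPlot p → ∀ a : Eucl n,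
    ∃ (V : Set (Eucl n)) (q : V → E), IsOpen V ∧ a ∈ V ∧ DSmooth q ∧ (∀ b : V, π (q b) = p b) ∧
      ∃ ψ : V × G → {z : V × E // p z.1 = π z.2}, IsDiffeomorphism ψ ∧
        ∀ (b : V) (g : G), (ψ (b, g) : V × E) = (b, g • q b)

variable [DiffeologicalAction G E]

variable {G} in
/-- The local path `t ↦ g(t) • γ(t)`. -/
def LocalPath.gauge (γ : LocalPath E) (g : SmoothMap γ.dom G) : LocalPath E where
  dom := γ.dom
  isOpen := γ.isOpen
  ordConnected := γ.ordConnected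
  nonempty := γ.nonempty
  curve := ⟨fun t ↦ g t • γ.curve t,
    DiffeologicalAction.smooth_smul.comp (DSmooth.prodMk g.smooth γ.curve.smooth)⟩

variable {G} in
/-- The local path `t ↦ g • γ(t)`, for a fixed `g ∈ G`. -/
def LocalPath.smul (g : G) (γ : LocalPath E) : LocalPath E :=
  γ.gauge ⟨fun _ ↦ g, dSmooth_const⟩

variable {G} in
/-- The local path `t ↦ c(t) • y`, for a local path `c` in `G` and `y ∈ E`. -/
def LocalPath.orbit (c : LocalPath G) (y : E) : LocalPath E where
  dom := c.dom
  isOpen := c.isOpen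
  ordConnected := c.ordConnected
  nonempty := c.nonempty
  curve := ⟨fun t ↦ c.curve t • y,
    DiffeologicalAction.smooth_smul.comp (DSmooth.prodMk c.curve.smooth dSmooth_const)⟩

variable (E) in
/-- A connection `1`-form: a smooth, fibrewise linear, `G`-equivariant map `α : TE → T_e G` with
`α (d/dt|₀ (c(t) • y)) = dc/dt(0)` for every smooth curve `c` in `G` with `c(0) = e`. -/
structure ConnectionForm [DiffeologicalGroup G] where
  form : ∀ y : E, InternalTangentSpace y →ₗ[ℝ] InternalTangentSpace (1 : G)
  smooth : DSmooth (fun z : InternalTangentBundle E ↦ form z.pt z.vec)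
  equivariant : ∀ (g : G) (y : E) (v : InternalTangentSpace y),
    form (g • y) (InternalTangentSpace.map (fun y' ↦ g • y') (dSmooth_smul g) rfl v) =
      Ad g (form y v)
  vertical : ∀ (y : E) (c : LocalPath G) (h0 : 0 ∈ c.dom) (h1 : c.curve ⟨0, h0⟩ = 1),
    form y (velocity (c.orbit y).curve ⟨0, h0⟩ (by rw [(c.orbit y).isOpen.interior_eq]; exact h0)
      (show c.curve ⟨0, h0⟩ • y = y by rw [h1, one_smul])) =
    velocity c.curve ⟨0, h0⟩ (by rw [c.isOpen.interior_eq]; exact h0) h1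

/-- A diffeological connection on `π : E → X`. -/
structure IsDiffeologicalConnection (π : E → X) (θ : TbLocalPath E → LocalPath E) : Prop where
  smooth : DSmooth θ
  dom_eq : ∀ (γ : LocalPath E) (t₀ : ℝ) (h : t₀ ∈ γ.dom), (θ ⟨(γ, t₀), h⟩).dom = γ.dom
  proj_eq : ∀ (γ : LocalPath E) (t₀ : ℝ) (h : t₀ ∈ γ.dom) (t : γ.dom),
    π ((θ ⟨(γ, t₀), h⟩).curve ⟨t, by rw [dom_eq]; exact t.2⟩) = π (γ.curve t)
  apply_self : ∀ (γ : LocalPath E) (t₀ : ℝ) (h : t₀ ∈ γ.dom),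
    (θ ⟨(γ, t₀), h⟩).curve ⟨t₀, by rw [dom_eq]; exact h⟩ = γ.curve ⟨t₀, h⟩
  smul : ∀ (g : G) (γ : LocalPath E) (t₀ : ℝ) (h : t₀ ∈ γ.dom),
    θ ⟨(LocalPath.smul g γ, t₀), h⟩ = LocalPath.smul g (θ ⟨(γ, t₀), h⟩)
  comp : ∀ (γ : LocalPath E) (f : LocalPath ℝ) (hf : ∀ t, f.curve t ∈ γ.dom) (s : f.dom),
    θ ⟨(γ.comp f hf, s), s.2⟩ =
      (θ ⟨(γ, f.curve s), hf s⟩).comp f (fun t ↦ by rw [dom_eq]; exact hf t)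
  idem : ∀ (γ : LocalPath E) (t₀ : ℝ) (h : t₀ ∈ γ.dom),
    θ ⟨(θ ⟨(γ, t₀), h⟩, t₀), by simpa only [dom_eq] using h⟩ = θ ⟨(γ, t₀), h⟩

variable {G} in
/-- The local path `γ` is horizontal: `α (dγ/dt) = 0` at all times. -/
def ConnectionForm.IsHorizontal [DiffeologicalGroup G] (α : ConnectionForm G E)
    (γ : LocalPath E) : Prop :=
  ∀ t : γ.dom, α.form (γ.curve t) (γ.velocity t) = 0

end Bundles

end Diffeology

end

open Diffeology

/-! Write δg for the right logarithmic derivative. The Leibniz rule for velocities, the equivariance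
of ω and its normalisation on orbits give ω(d/dt(g·γ)) = Ad_g ω(γ̇) + δg (`form_velocity_gauge`).
Since Ad_g δ(g⁻¹) = -δg, the curve g·γ is horizontal exactly when h = g⁻¹ solves δh = ω(γ̇)
(`isHorizontal_gauge_iff`). Everything thus reduces to solving δh = ξ, h(t₀) = e on an open
interval, smoothly in ξ, t₀ and t.

Regularity solves this only on [0,1], with the equation known only on (0,1). For each t, rescale ξ
along the segment from t₀ to t, in either direction, and let h(t) be the value at 1 of the resulting
exponential. Uniqueness on [0,1] shows that these values fit together along a segment
(`exp_segment_apply`). A time t ≠ t₀ is interior to a slightly longer segment, so the equation holds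
there; at t₀ it follows by continuity, tested against the smooth linear functionals that separate
points of T_eG. Uniqueness of h also comes from rescaling to [0,1].

Smooth dependence needs the velocity to be smooth as a map from tautological local paths to TE
(`LocalPath.dSmooth_velocity`): for a smooth family (γ_a, t_a), the map (a, s) ↦ γ_a(t_a + s) is a
plot, and the velocity is its tangent map on a constant vector. Then ω and exp are applied to smooth
families. Preservation of fibres comes from local triviality. The equivariance, reparametrisation
and idempotence axioms follow from uniqueness, by exhibiting a horizontal gauge transform with the
right initial value. -/

noncomputable section

namespace Diffeology

open scoped ContDiff Topology

universe u v w

/-! ### Calculus of smooth maps and function spaces. -/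

section Smoothness

variable {X : Type u} {Y : Type v} {Z : Type w} [DiffeologicalSpace X] [DiffeologicalSpace Y]
  [DiffeologicalSpace Z]

theorem dSmooth_fst : DSmooth (Prod.fst : X × Y → X) := fun _ _ hp ↦ hp.1

theorem dSmooth_snd : DSmooth (Prod.snd : X × Y → Y) := fun _ _ hp ↦ hp.2

theorem DSmooth.fst {f : X → Y × Z} (hf : DSmooth f) : DSmooth (fun x ↦ (f x).1) :=
  dSmooth_fst.comp hf

theorem DSmooth.snd {f : X → Y × Z} (hf : DSmooth f) : DSmooth (fun x ↦ (f x).2) :=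
  dSmooth_snd.comp hf

theorem DSmooth.subtype_val {P : Y → Prop} {f : X → {y : Y // P y}} (hf : DSmooth f) :
    DSmooth (fun x ↦ (f x : Y)) :=
  (dSmooth_subtype_val P).comp hf

theorem DSmooth.add {f g : X → ℝ} (hf : DSmooth f) (hg : DSmooth g) :
    DSmooth (fun x ↦ f x + g x) :=
  fun n p hp ↦ ((hf n p hp).contDiff.add (hg n p hp).contDiff).isPlot

theorem DSmooth.sub {f g : X → ℝ} (hf : DSmooth f) (hg : DSmooth g) :
    DSmooth (fun x ↦ f x - g x) :=
  fun n p hp ↦ ((hf n p hp).contDiff.sub (hg n p hp).contDiff).isPlot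

theorem DSmooth.mul {f g : X → ℝ} (hf : DSmooth f) (hg : DSmooth g) :
    DSmooth (fun x ↦ f x * g x) :=
  fun n p hp ↦ ((hf n p hp).contDiff.mul (hg n p hp).contDiff).isPlot

theorem DSmooth.inv {G : Type v} [Group G] [DiffeologicalSpace G] [DiffeologicalGroup G]
    {f : X → G} (hf : DSmooth f) : DSmooth (fun x ↦ (f x)⁻¹) :=
  DiffeologicalGroup.smooth_inv.comp hf

theorem DSmooth.group_mul {G : Type v} [Group G] [DiffeologicalSpace G] [DiffeologicalGroup G]
    {f g : X → G} (hf : DSmooth f) (hg : DSmooth g) : DSmooth (fun x ↦ f x * g x) :=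
  DiffeologicalGroup.smooth_mul.comp (hf.prodMk hg)

theorem DSmooth.action_smul {G : Type v} {E : Type w} [Group G] [DiffeologicalSpace G]
    [DiffeologicalSpace E] [MulAction G E] [DiffeologicalAction G E]
    {f : X → G} {g : X → E} (hf : DSmooth f) (hg : DSmooth g) : DSmooth (fun x ↦ f x • g x) :=
  DiffeologicalAction.smooth_smul.comp (hf.prodMk hg)

/-- A smooth real function on an open set of reals is smooth in the usual sense. -/
theorem DSmooth.contDiffOn_of_eq {S : Set ℝ} (hS : IsOpen S) {f : S → ℝ} (hf : DSmooth f)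
    {φ : ℝ → ℝ} (h : ∀ s : S, φ s = f s) : ContDiffOn ℝ ∞ φ S := by
  intro t ht
  obtain ⟨ε, hε, hball⟩ := Metric.isOpen_iff.mp hS t ht
  -- Plots are defined on all of ℝⁿ, so `f` is tested through a diffeomorphism `b` of ℝ onto a ball
  -- inside `S`, which is then undone.
  set b := OpenPartialHomeomorph.univBall t ε with hb
  have hmem : ∀ x, b x ∈ Metric.ball t ε := fun x ↦ by
    have := b.map_source (x := x) (by simp [hb])
    rwa [hb, OpenPartialHomeomorph.univBall_target t hε] at this
  have hbs : ContDiff ℝ ∞ b := OpenPartialHomeomorph.contDiff_univBall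
  have h1 : ContDiff ℝ ∞ (φ ∘ b) := by
    have h2 : DSmooth (fun x ↦ f ⟨b x, hball (hmem x)⟩) :=
      hf.comp (hbs.dSmooth.subtype_mk fun x ↦ hball (hmem x))
    have h3 : φ ∘ b = fun x ↦ f ⟨b x, hball (hmem x)⟩ := funext fun x ↦ h ⟨b x, _⟩
    rw [h3]
    exact h2.contDiff
  have h4 : ContDiffOn ℝ ∞ (φ ∘ b ∘ b.symm) (Metric.ball t ε) :=
    h1.comp_contDiffOn OpenPartialHomeomorph.contDiffOn_univBall_symm
  have h5 : ContDiffOn ℝ ∞ φ (Metric.ball t ε) := h4.congr fun x hx ↦ by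
    have : b (b.symm x) = x :=
      b.right_inv (by rwa [hb, OpenPartialHomeomorph.univBall_target t hε])
    simp [this]
  exact (h5.contDiffAt (Metric.ball_mem_nhds t hε)).contDiffWithinAt

theorem SmoothMap.dSmooth_eval (x : X) : DSmooth (fun f : SmoothMap X Y ↦ f x) := by
  intro n p hp
  exact hp n (fun a ↦ (a, x)) ⟨isPlot_id, isPlot_const⟩

/-- Smoothness of a map into a function space from smoothness in both variables. -/
theorem SmoothMap.dSmooth_of_uncurry {f : Z → SmoothMap X Y}
    (hf : DSmooth (fun z : Z × X ↦ f z.1 z.2)) : DSmooth f := by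
  intro n p hp m q hq
  exact hf m (fun a ↦ (p (q a).1, (q a).2)) ⟨hp.dSmooth.comp hq.1.dSmooth |>.isPlot, hq.2⟩

end Smoothness

/-! ### The functional diffeology on local paths. -/

namespace LocalPath

section

variable {X : Type u} {Y : Type v} {Z : Type w} [DiffeologicalSpace X] [DiffeologicalSpace Y]
  [DiffeologicalSpace Z]

/-- A global plot is the case `U = univ` of the defining condition, where `A ⊆ U` is vacuous. -/
theorem isPlot_iff {n : ℕ} {p : Eucl n → LocalPath X} :
    IsPlot p ↔ ∀ a, ∀ t ∈ (p a).dom,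
      ∃ (A : Set (Eucl n)) (B : Set ℝ), IsOpen A ∧ a ∈ A ∧ IsOpen B ∧ t ∈ B ∧
        ∃ h : ∀ a' ∈ A, B ⊆ (p a').dom,
          DSmooth (fun z : A × B ↦ (p z.1).curve ⟨z.2, h z.1 z.1.2 z.2.2⟩) := by
  constructor
  · intro hp a t ht
    obtain ⟨A, B, hA, haA, -, hB, htB, h⟩ := hp a trivial t ht
    exact ⟨A, B, hA, haA, hB, htB, h⟩
  · intro hp a _ t ht
    obtain ⟨A, B, hA, haA, hB, htB, h⟩ := hp a t ht
    exact ⟨A, B, hA, haA, Set.subset_univ _, hB, htB, h⟩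

theorem isOpen_setOf_mem_dom {n : ℕ} {p : Eucl n → LocalPath X} (hp : IsPlot p) :
    IsOpen {z : Eucl n × ℝ | z.2 ∈ (p z.1).dom} := by
  rw [isOpen_iff_mem_nhds]
  rintro ⟨a, t⟩ ht
  obtain ⟨A, B, hA, haA, hB, htB, h, -⟩ := isPlot_iff.1 hp a t ht
  filter_upwards [prod_mem_nhds (hA.mem_nhds haA) (hB.mem_nhds htB)] with z hz
  exact h z.1 hz.1 hz.2

/-- The evaluation of local paths is smooth. -/
theorem dSmooth_eval : DSmooth (fun z : TbLocalPath X ↦ z.1.1.curve ⟨z.1.2, z.2⟩) := by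
  intro n q hq
  refine DiffeologicalSpace.locality fun a ↦ ?_
  have hτ : ContDiff ℝ ∞ (fun b ↦ (q b).1.2) := IsPlot.contDiff hq.2
  obtain ⟨A, B, hA, haA, hB, htB, h, hs⟩ := isPlot_iff.1 hq.1 a _ (q a).2
  refine ⟨A ∩ (fun b ↦ (q b).1.2) ⁻¹' B, hA.inter (hB.preimage hτ.continuous), ⟨haA, htB⟩, ?_⟩
  intro m f hf hfs
  exact hs m (fun b ↦ (⟨f b, (hf b).1⟩, ⟨(q (f b)).1.2, (hf b).2⟩))
    ⟨hfs.isPlot (X := Eucl n), (hτ.comp hfs).isPlot⟩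

/-- A family of local paths is smooth if the domains are those of a smooth family of local paths
and the values depend smoothly on both variables. -/
theorem dSmooth_of_uncurry {p : Z → LocalPath X} (hp : DSmooth p) {Φ : Z → LocalPath Y}
    (hdom : ∀ z, (Φ z).dom = (p z).dom)
    (hΦ : DSmooth (fun w : {w : Z × ℝ // w.2 ∈ (p w.1).dom} ↦
      (Φ w.1.1).curve ⟨w.1.2, by rw [hdom]; exact w.2⟩)) : DSmooth Φ := by
  intro n q hq
  refine isPlot_iff.2 fun a t ht ↦ ?_
  obtain ⟨A, B, hA, haA, hB, htB, h, -⟩ :=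
    isPlot_iff.1 (hp n q hq) a t (by simpa only [Function.comp, hdom] using ht)
  refine ⟨A, B, hA, haA, hB, htB, fun a' ha' ↦ by
    simpa only [Function.comp, hdom] using h a' ha', ?_⟩
  intro m r hr
  exact hΦ m (fun b ↦ ⟨(q (r b).1, (r b).2), h _ (r b).1.2 (r b).2.2⟩)
    ⟨hq.dSmooth.comp (dSmooth_subtype_val _ |>.comp (IsPlot.dSmooth hr.1)) |>.isPlot, hr.2⟩

theorem ext_of_eqOn {γ δ : LocalPath X} (hdom : γ.dom = δ.dom)
    (h : ∀ t (h₁ : t ∈ γ.dom) (h₂ : t ∈ δ.dom), γ.curve ⟨t, h₁⟩ = δ.curve ⟨t, h₂⟩) : γ = δ := by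
  obtain ⟨S, _, _, _, c⟩ := γ
  obtain ⟨T, _, _, _, d⟩ := δ
  obtain rfl : S = T := hdom
  congr 1
  ext t
  exact h t t.2 t.2

end

end LocalPath

/-! ### Internal tangent spaces and smoothness of the velocity map. -/

section Tangent

variable {X : Type u} {Y : Type v} {Z : Type w} [DiffeologicalSpace X] [DiffeologicalSpace Y]
  [DiffeologicalSpace Z]

/-- The restriction of a pointed plot to a smaller open neighbourhood of `0`. -/
def PointedPlot.restrict {x : X} (p : PointedPlot x) (N : Set (Eucl p.dim)) (hN : IsOpen N)
    (h0 : 0 ∈ N) (hNp : N ⊆ p.dom) : PointedPlot x where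
  dim := p.dim
  dom := N
  isOpen := hN
  zero_mem := h0
  toFun a := p.toFun ⟨a, hNp a.2⟩
  smooth := p.smooth.comp ((dSmooth_subtype_val _).subtype_mk _)
  map_zero := p.map_zero

/-- The inclusion of the smaller domain is an arrow whose derivative at 0 is the identity. -/
theorem PointedPlot.restrict_pushforward {x : X} (p : PointedPlot x) {N : Set (Eucl p.dim)}
    (hN : IsOpen N) (h0 : 0 ∈ N) (hNp : N ⊆ p.dom) (v : Eucl p.dim) :
    (p.restrict N hN h0 hNp).pushforward v = p.pushforward v := by
  have h : (p.restrict N hN h0 hNp).IsArrow p (fun a ↦ a) :=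
    ⟨contDiffOn_id, rfl, hNp, fun a ↦ rfl⟩
  exact (h.pushforward_eq v).trans
    (congrArg p.pushforward (DFunLike.congr_fun (hasFDerivAt_id (𝕜 := ℝ) (0 : Eucl p.dim)).fderiv v))

/-- Tangent vectors are compatible with arrows that are only defined near `0`. -/
theorem PointedPlot.pushforward_eq_of_hasFDerivAt {x : X} (p q : PointedPlot x)
    {f : Eucl p.dim → Eucl q.dim} {N : Set (Eucl p.dim)} (hN : IsOpen N) (h0 : 0 ∈ N)
    (hNp : N ⊆ p.dom) (hf : ContDiffOn ℝ ∞ f N) (hf0 : f 0 = 0) (hmaps : Set.MapsTo f N q.dom)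
    (heq : ∀ a (ha : a ∈ N), q.toFun ⟨f a, hmaps ha⟩ = p.toFun ⟨a, hNp ha⟩)
    {f' : Eucl p.dim →L[ℝ] Eucl q.dim} (hf' : HasFDerivAt f f' 0) (v : Eucl p.dim) :
    p.pushforward v = q.pushforward (f' v) := by
  have h : (p.restrict N hN h0 hNp).IsArrow q f := ⟨hf, hf0, hmaps, fun a ↦ heq a.1 a.2⟩
  exact (p.restrict_pushforward hN h0 hNp v).symm.trans ((h.pushforward_eq v).trans
    (congrArg q.pushforward (DFunLike.congr_fun hf'.fderiv v)))

/-- Used when the two base points agree only propositionally: `heq` at 0 identifies them, so the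
comparison has to take place in the total space. -/
theorem PointedPlot.mk_pushforward_eq {x y : X} (p : PointedPlot x) (q : PointedPlot y)
    (f : Eucl p.dim →L[ℝ] Eucl q.dim) (hmaps : Set.MapsTo f p.dom q.dom)
    (heq : ∀ a : p.dom, q.toFun ⟨f a, hmaps a.2⟩ = p.toFun a) (v : Eucl p.dim) :
    (⟨x, p.pushforward v⟩ : InternalTangentBundle X) = ⟨y, q.pushforward (f v)⟩ := by
  obtain rfl : x = y := by
    rw [← p.map_zero, ← q.map_zero, ← heq]
    simp
  congr 1
  exact p.pushforward_eq_of_hasFDerivAt q p.isOpen p.zero_mem subset_rfl f.contDiff.contDiffOn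
    (_root_.map_zero f) hmaps (fun a ha ↦ heq ⟨a, ha⟩) f.hasFDerivAt v

open Classical in
theorem InternalTangentSpace.map_pushforward {x : X} {y : Y} (f : X → Y) (hf : DSmooth f)
    (h : f x = y) (p : PointedPlot x) (v : Eucl p.dim) :
    InternalTangentSpace.map f hf h (p.pushforward v) = (p.postcomp f hf h).pushforward v :=
  by
  change DirectSum.toModule ℝ (PointedPlot x) (InternalTangentSpace y)
    (fun p ↦ (p.postcomp f hf h).pushforward)
    (DirectSum.lof ℝ (PointedPlot x) (fun p ↦ Eucl p.dim) p v) = _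
  exact DirectSum.toModule_lof ℝ (M := fun p : PointedPlot x ↦ Eucl p.dim) p v

open Classical in
/-- Linear maps on a tangent space are determined by their values on the vectors `p_* v`. -/
theorem InternalTangentSpace.linearMap_ext {x : X} {M : Type*} [AddCommGroup M] [Module ℝ M]
    {l l' : InternalTangentSpace x →ₗ[ℝ] M}
    (h : ∀ (p : PointedPlot x) (v : Eucl p.dim), l (p.pushforward v) = l' (p.pushforward v)) :
    l = l' := by
  refine Submodule.linearMap_qext (tangentRelations x) ?_
  refine DirectSum.linearMap_ext ℝ fun p ↦ ?_
  ext1 v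
  exact h p v

/-- The closure properties in `IsTangentDiffeology` pass to the intersection, since a plot of it is
a plot for every member. -/
theorem smooth_smul_tangentBundle : DSmooth (fun z : ℝ × InternalTangentBundle X ↦
    (⟨z.2.pt, z.1 • z.2.vec⟩ : InternalTangentBundle X)) := by
  intro n p hp
  refine DiffeologicalSpace.isPlot_sInf_iff.2 fun d hd ↦ ?_
  exact hd.smooth_smul n p ⟨hp.1, DiffeologicalSpace.isPlot_sInf_iff.1 hp.2 d hd⟩

theorem smooth_plotTangentMap {n : ℕ} {U : Set (Eucl n)} (hU : IsOpen U) (p : U → X)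
    (hp : DSmooth p) : DSmooth (plotTangentMap hU p hp) := by
  intro m q hq
  refine DiffeologicalSpace.isPlot_sInf_iff.2 fun d hd ↦ ?_
  exact hd.smooth_plot n U hU p hp m q hq

theorem DSmooth.tangent_smul {x : X} {f : Z → ℝ} {g : Z → InternalTangentSpace x}
    (hf : DSmooth f) (hg : DSmooth g) : DSmooth (fun z ↦ f z • g z) :=
  fun n p hp ↦ smooth_smul_tangentBundle n (fun a ↦ (f (p a), ⟨x, g (p a)⟩))
    ⟨hf n p hp, hg n p hp⟩

/-- The velocity of a local path, as a point of the tangent bundle, is a smooth function of the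
path and the time. -/
theorem LocalPath.dSmooth_velocity : DSmooth (fun z : TbLocalPath X ↦
    (⟨_, z.1.1.velocity ⟨z.1.2, z.2⟩⟩ : InternalTangentBundle X)) := by
  intro n q hq
  -- A point of ℝⁿ⁺¹ is read as (a, s). Below, `P` is (a, s) ↦ γ_a(t_a + s) on the open set `W`
  -- where this is defined, and `ι` is a ↦ (a, 0).
  let init : Eucl (n + 1) → Eucl n := fun z ↦ WithLp.toLp 2 fun i ↦ z i.castSucc
  have hinit : ContDiff ℝ ∞ init := contDiff_euclidean.2 fun i ↦ by
    simp only [init]; fun_prop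
  let τ : Eucl (n + 1) → ℝ := fun z ↦ (q (init z)).1.2 + z (Fin.last n)
  have hq2 : ContDiff ℝ ∞ (fun b ↦ (q b).1.2) := IsPlot.contDiff hq.2
  have hτ : ContDiff ℝ ∞ τ := (hq2.comp hinit).add (by fun_prop)
  let W : Set (Eucl (n + 1)) := {z | τ z ∈ (q (init z)).1.1.dom}
  have hW : IsOpen W := (isOpen_setOf_mem_dom hq.1).preimage
    (hinit.continuous.prodMk hτ.continuous)
  let P : W → X := fun z ↦ (q (init z)).1.1.curve ⟨τ z, z.2⟩
  have hP : DSmooth P := dSmooth_eval.comp (f := fun z : W ↦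
    (⟨((q (init z)).1.1, τ z), z.2⟩ : TbLocalPath X)) <| by
      refine DSmooth.subtype_mk (DSmooth.prodMk ?_ ?_) _
      · exact (IsPlot.dSmooth hq.1).comp (hinit.dSmooth.comp (dSmooth_subtype_val _))
      · exact hτ.dSmooth.comp (dSmooth_subtype_val _)
  let ι : Eucl n → Eucl (n + 1) := fun a ↦ WithLp.toLp 2 (Fin.snoc (α := fun _ ↦ ℝ) a 0)
  have hι : ContDiff ℝ ∞ ι := contDiff_euclidean.2 fun i ↦ by
    refine Fin.lastCases ?_ (fun j ↦ ?_) i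
    · simpa [ι] using contDiff_const
    · simp only [ι, Fin.snoc_castSucc]; fun_prop
  have hinit_add : ∀ (a : Eucl n) (s : ℝ),
      init (ι a + s • EuclideanSpace.single (Fin.last n) 1) = a := fun a s ↦ by
    ext i
    simp [init, ι]
  have hlast_add : ∀ (a : Eucl n) (s : ℝ),
      (ι a + s • EuclideanSpace.single (Fin.last n) 1 : Eucl (n + 1)) (Fin.last n) = s :=
    fun a s ↦ by simp [ι]
  have hτ_add : ∀ (a : Eucl n) (s : ℝ),
      τ (ι a + s • EuclideanSpace.single (Fin.last n) 1) = (q a).1.2 + s := fun a s ↦ by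
    simp only [τ, hinit_add, hlast_add]
  have hmem : ∀ (a : Eucl n) (s : ℝ), ι a + s • EuclideanSpace.single (Fin.last n) 1 ∈ W ↔
      (q a).1.2 + s ∈ (q a).1.1.dom := fun a s ↦ by
    simp only [W, Set.mem_ofPred_eq, hτ_add, hinit_add]
  have hιW : ∀ a, ι a ∈ W := fun a ↦ by simpa using (hmem a 0).2 (by simpa using (q a).2)
  have hcurve : ∀ (γ δ : LocalPath X) (s t : ℝ) (hs : s ∈ γ.dom) (ht : t ∈ δ.dom), γ = δ →
      s = t → γ.curve ⟨s, hs⟩ = δ.curve ⟨t, ht⟩ := by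
    rintro γ _ s _ hs ht rfl rfl
    rfl
  -- The inclusion of the s-axis: an arrow from the velocity plot of γ_a to `P` translated to (a,
  -- 0), so the velocity is the tangent map of `P` on the last basis vector.
  let f : Eucl 1 →L[ℝ] Eucl (n + 1) :=
    (EuclideanSpace.proj (0 : Fin 1)).smulRight (EuclideanSpace.single (Fin.last n) 1)
  have key := smooth_plotTangentMap hW P hP n
    (fun a ↦ (⟨ι a, hιW a⟩, EuclideanSpace.single (Fin.last n) 1))
    ⟨hι.isPlot (X := Eucl (n + 1)), isPlot_const⟩
  convert! key using 1
  funext a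
  have hint := (q a).1.1.isOpen.interior_eq
  have := PointedPlot.mk_pushforward_eq
    (velocityPlot (q a).1.1.curve ⟨(q a).1.2, (q a).2⟩ (by rw [hint]; exact (q a).2) rfl)
    (translatedPlot hW P hP ⟨ι a, hιW a⟩) f
    (fun (s : Eucl 1) hs ↦ (hmem a (s 0)).2 (interior_subset hs))
    (fun s ↦ hcurve _ _ _ _ _ _
      (congrArg (fun b ↦ (q b).1.1) (hinit_add a (WithLp.ofLp (V := Fin 1 → ℝ) s.1 0)))
      (hτ_add a (WithLp.ofLp (V := Fin 1 → ℝ) s.1 0)))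
    (EuclideanSpace.single (0 : Fin 1) (1 : ℝ))
  refine this.trans ?_
  have hf : f (EuclideanSpace.single (0 : Fin 1) (1 : ℝ)) = EuclideanSpace.single (Fin.last n) 1 := by
    simp [f]
  simp only [Function.comp, plotTangentMap]
  exact congrArg _ (congrArg _ hf)

end Tangent

/-! ### Chain and Leibniz rules for velocities. -/

section Velocity

variable {X : Type u} {Y : Type v} {Z : Type w} [DiffeologicalSpace X] [DiffeologicalSpace Y]
  [DiffeologicalSpace Z]

/-- A lift `f` of the curve through `q` near time `t` is an arrow from the velocity plot to `q`,
once ℝ is identified with `Eucl 1`. Velocities are thereby computed by ordinary derivatives. -/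
theorem velocity_eq_pushforward {S : Set ℝ} (c : SmoothMap S X) (t : S)
    (ht : (t : ℝ) ∈ interior S) {x : X} (hc : c t = x) (q : PointedPlot x) {f : ℝ → Eucl q.dim}
    {N : Set ℝ} (hN : IsOpen N) (h0 : 0 ∈ N) (hNS : ∀ s ∈ N, (t : ℝ) + s ∈ interior S)
    (hf : ContDiffOn ℝ ∞ f N) (hf0 : f 0 = 0) (hmaps : Set.MapsTo f N q.dom)
    (heq : ∀ s (hs : s ∈ N), q.toFun ⟨f s, hmaps hs⟩ = c ⟨(t : ℝ) + s, interior_subset (hNS s hs)⟩)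
    {w : Eucl q.dim} (hw : HasDerivAt f w 0) :
    velocity c t ht hc = q.pushforward w := by
  let π₀ : Eucl 1 →L[ℝ] ℝ := EuclideanSpace.proj (0 : Fin 1)
  have hw' : HasFDerivAt (f ∘ π₀) ((ContinuousLinearMap.toSpanSingleton ℝ w).comp π₀) 0 :=
    HasFDerivAt.comp (0 : Eucl 1) (by simpa [π₀] using hw.hasFDerivAt) π₀.hasFDerivAt
  have key := PointedPlot.pushforward_eq_of_hasFDerivAt (velocityPlot c t ht hc) q
    (f := f ∘ π₀) (N := π₀ ⁻¹' N) (hN.preimage π₀.continuous) h0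
    (fun (s : Eucl 1) hs ↦ hNS (s 0) hs)
    (hf.comp π₀.contDiff.contDiffOn fun s hs ↦ hs) ((congrArg f (map_zero π₀)).trans hf0)
    (fun (s : Eucl 1) hs ↦ hmaps hs) (fun (s : Eucl 1) hs ↦ heq (s 0) hs)
    hw' (EuclideanSpace.single (0 : Fin 1) (1 : ℝ))
  refine key.trans (congrArg _ ?_)
  change π₀ (EuclideanSpace.single (0 : Fin 1) (1 : ℝ)) • w = w
  simp [π₀]

/-- The chain rule for reparametrisations of curves. -/
theorem velocity_reparam {S T N : Set ℝ} (c : SmoothMap S X) (d : SmoothMap T X) {φ : ℝ → ℝ}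
    (hN : IsOpen N) (hφ : ContDiffOn ℝ ∞ φ N) (t : T) (htN : (t : ℝ) ∈ N) (u : S)
    (hu : φ t = u) (ht : (t : ℝ) ∈ interior T) (hu' : (u : ℝ) ∈ interior S)
    (heq : ∀ s ∈ N, ∀ (h₁ : s ∈ T) (h₂ : φ s ∈ S), d ⟨s, h₁⟩ = c ⟨φ s, h₂⟩) {x : X}
    (hd : d t = x) (hc : c u = x) :
    velocity d t ht hd = deriv φ t • velocity c u hu' hc := by
  -- Pointed plots are based at 0, so `φ` is recentred at `t` in the source and at `φ t` in the
  -- target.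
  let f : ℝ → Eucl 1 := fun s ↦ (φ (t + s) - φ t) • EuclideanSpace.single 0 1
  have hf' : HasDerivAt f (deriv φ t • EuclideanSpace.single 0 1) 0 := by
    have h : HasDerivAt φ (deriv φ t) (t + 0) := by
      simpa using ((hφ.contDiffAt (hN.mem_nhds htN)).differentiableAt (by simp)).hasDerivAt
    exact ((h.comp_const_add (t : ℝ) 0).sub_const _).smul_const _
  have hf0 : ∀ s, (u : ℝ) + f s 0 = φ (t + s) := fun s ↦ by simp [f, hu]
  have hM : IsOpen ((N ∩ interior T) ∩ φ ⁻¹' interior S) :=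
    (hφ.continuousOn.mono Set.inter_subset_left).isOpen_inter_preimage
      (hN.inter isOpen_interior) isOpen_interior
  have hcts : Continuous (fun s : ℝ ↦ (t : ℝ) + s) := by fun_prop
  rw [velocity_eq_pushforward d t ht hd (velocityPlot c u hu' hc) (f := f)
    (hM.preimage hcts) (by simpa [hu] using ⟨⟨htN, ht⟩, hu'⟩) (fun s hs ↦ hs.1.2)
    (((hφ.comp (contDiff_const.add contDiff_id).contDiffOn fun s hs ↦ hs.1.1).sub
      contDiffOn_const).smul contDiffOn_const)
    (by simp only [f, add_zero, sub_self, zero_smul]; rfl)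
    (fun s hs ↦ by
      change (u : ℝ) + f s 0 ∈ interior S
      rw [hf0]; exact hs.2)
    (fun s hs ↦ by
      change c ⟨(u : ℝ) + f s 0, _⟩ = d ⟨t + s, _⟩
      rw [heq _ hs.1.1 _ (interior_subset hs.2)]
      congr 2
      exact hf0 s) hf']
  exact map_smul _ _ _

theorem velocity_congr {S : Set ℝ} {c d : SmoothMap S X} (h : ∀ s, c s = d s) (t : S)
    (ht : (t : ℝ) ∈ interior S) {x : X} (hc : c t = x) (hd : d t = x) :
    velocity c t ht hc = velocity d t ht hd := by
  obtain rfl : c = d := SmoothMap.ext (funext h)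
  rfl

/-- A constant curve is its own reparametrisation by a constant function, whose derivative is 0. -/
theorem velocity_eq_zero_of_const {S : Set ℝ} (c : SmoothMap S X) (t : S)
    (ht : (t : ℝ) ∈ interior S) {x : X} (hc : ∀ s, c s = x) : velocity c t ht (hc t) = 0 := by
  have := velocity_reparam c c (φ := fun _ ↦ (t : ℝ)) isOpen_univ contDiffOn_const t trivial t rfl
    ht ht (fun s _ h₁ h₂ ↦ (hc _).trans (hc _).symm) (hc t) (hc t)
  simpa using this

theorem map_velocity {S : Set ℝ} (c : SmoothMap S X) (t : S) (ht : (t : ℝ) ∈ interior S) {x : X}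
    (hc : c t = x) (f : X → Y) (hf : DSmooth f) {y : Y} (hy : f x = y) :
    InternalTangentSpace.map f hf hy (velocity c t ht hc) =
      velocity ⟨fun s ↦ f (c s), hf.comp c.smooth⟩ t ht
        (show f (c t) = y by rw [hc, hy]) :=
  InternalTangentSpace.map_pushforward f hf hy _ _

/-- The Leibniz rule for curves. -/
theorem velocity_map₂ {S : Set ℝ} (c : SmoothMap S X) (d : SmoothMap S Y) (F : X × Y → Z)
    (hF : DSmooth F) (t : S) (ht : (t : ℝ) ∈ interior S) {z : Z} (hz : F (c t, d t) = z) :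
    velocity ⟨fun s ↦ F (c s, d s), hF.comp (c.smooth.prodMk d.smooth)⟩ t ht hz =
      velocity ⟨fun s ↦ F (c s, d t), hF.comp (c.smooth.prodMk dSmooth_const)⟩ t ht hz +
      velocity ⟨fun s ↦ F (c t, d s), hF.comp (dSmooth_const.prodMk d.smooth)⟩ t ht hz := by
  -- With two independent times, the three curves are `P` along the lines spanned by (1,1), (1,0)
  -- and (0,1); the claim is linearity of the pushforward.
  let P : PointedPlot z :=
    { dim := 2
      dom := {s | (t : ℝ) + s 0 ∈ interior S ∧ (t : ℝ) + s 1 ∈ interior S}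
      isOpen := (isOpen_interior.preimage (by fun_prop)).inter
        (isOpen_interior.preimage (by fun_prop))
      zero_mem := by simpa using ht
      toFun := fun s ↦ F (c ⟨(t : ℝ) + s.1 0, interior_subset s.2.1⟩,
        d ⟨(t : ℝ) + s.1 1, interior_subset s.2.2⟩)
      smooth := by
        refine hF.comp (DSmooth.prodMk (c.smooth.comp (DSmooth.subtype_mk ?_ _))
          (d.smooth.comp (DSmooth.subtype_mk ?_ _)))
        · exact (ContDiff.dSmooth (f := fun s : Eucl 2 ↦ (t : ℝ) + s 0) (by fun_prop)).comp
            (dSmooth_subtype_val _)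
        · exact (ContDiff.dSmooth (f := fun s : Eucl 2 ↦ (t : ℝ) + s 1) (by fun_prop)).comp
            (dSmooth_subtype_val _)
      map_zero := by simpa using hz }
  have key : ∀ (e : SmoothMap S Z) (he : e t = z) (w : Eucl 2)
      (hmaps : ∀ s, (t : ℝ) + s ∈ interior S →
        (t : ℝ) + s * w 0 ∈ interior S ∧ (t : ℝ) + s * w 1 ∈ interior S)
      (_ : ∀ s (hs : (t : ℝ) + s ∈ interior S), F (c ⟨(t : ℝ) + s * w 0,
        interior_subset (hmaps s hs).1⟩, d ⟨(t : ℝ) + s * w 1, interior_subset (hmaps s hs).2⟩) =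
          e ⟨(t : ℝ) + s, interior_subset hs⟩),
      velocity e t ht he = P.pushforward w := by
    intro e he w hmaps heq
    refine velocity_eq_pushforward e t ht he P (f := fun s ↦ s • w)
      (isOpen_interior.preimage (continuous_const.add continuous_id)) (by simpa using ht)
      (fun s hs ↦ hs) (contDiff_id.smul contDiff_const).contDiffOn (zero_smul ℝ w)
      (fun s hs ↦ hmaps s hs) (fun s hs ↦ heq s hs) ?_
    simpa using (hasDerivAt_id (0 : ℝ)).smul_const w
  rw [key _ _ !₂[1, 1] (by simp) (by simp), key _ _ !₂[1, 0] (fun s hs ↦ by simpa using ⟨hs, ht⟩) (by simp),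
    key _ _ !₂[0, 1] (fun s hs ↦ by simpa using ⟨ht, hs⟩) (by simp), ← map_add]
  congr 1
  ext i
  fin_cases i <;> simp

end Velocity

/-! ### Functoriality of the tangent map. -/

section TangentMap

variable {X : Type u} {Y : Type v} {Z : Type w} [DiffeologicalSpace X] [DiffeologicalSpace Y]
  [DiffeologicalSpace Z]

theorem InternalTangentSpace.map_map {x : X} {y : Y} {z : Z} {f : X → Y} {g : Y → Z}
    (hf : DSmooth f) (hg : DSmooth g) (hx : f x = y) (hy : g y = z) (v : InternalTangentSpace x) :
    InternalTangentSpace.map g hg hy (InternalTangentSpace.map f hf hx v) =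
      InternalTangentSpace.map (fun a ↦ g (f a)) (hg.comp hf)
        (show g (f x) = z by rw [hx, hy]) v := by
  suffices h : InternalTangentSpace.map g hg hy ∘ₗ InternalTangentSpace.map f hf hx =
      InternalTangentSpace.map (fun a ↦ g (f a)) (hg.comp hf) (show g (f x) = z by rw [hx, hy])
    from LinearMap.congr_fun h v
  refine InternalTangentSpace.linearMap_ext fun p v ↦ ?_
  rw [LinearMap.comp_apply, InternalTangentSpace.map_pushforward,
    InternalTangentSpace.map_pushforward]
  exact InternalTangentSpace.map_pushforward g hg hy (p.postcomp f hf hx) v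

theorem InternalTangentSpace.map_eq_self {x : X} {f : X → X} (hf : DSmooth f) (hx : f x = x)
    (h : ∀ a, f a = a) (v : InternalTangentSpace x) : InternalTangentSpace.map f hf hx v = v := by
  obtain rfl : f = id := funext h
  suffices h : InternalTangentSpace.map id hf hx = LinearMap.id from LinearMap.congr_fun h v
  refine InternalTangentSpace.linearMap_ext fun p v ↦ ?_
  rw [InternalTangentSpace.map_pushforward]
  rfl

end TangentMap

/-! ### The right logarithmic derivative and the adjoint action. -/

section LogDeriv

variable {G : Type u} [Group G] [DiffeologicalSpace G] [DiffeologicalGroup G]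

/-- Translating the curve first, instead of its tangent vector, makes the rules for velocities
applicable inside T_eG. -/
theorem rightLogDeriv_eq_velocity {S : Set ℝ} (c : SmoothMap S G) (t : S)
    (ht : (t : ℝ) ∈ interior S) :
    rightLogDeriv c t ht =
      velocity ⟨fun s ↦ c s * (c t)⁻¹, (dSmooth_mul_right _).comp c.smooth⟩ t ht
        (mul_inv_cancel (c t)) :=
  map_velocity c t ht rfl _ _ _

theorem rightLogDeriv_reparam {S T N : Set ℝ} (c : SmoothMap S G) (d : SmoothMap T G) {φ : ℝ → ℝ}
    (hN : IsOpen N) (hφ : ContDiffOn ℝ ∞ φ N) (t : T) (htN : (t : ℝ) ∈ N) (u : S)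
    (hu : φ t = u) (ht : (t : ℝ) ∈ interior T) (hu' : (u : ℝ) ∈ interior S)
    (heq : ∀ s ∈ N, ∀ (h₁ : s ∈ T) (h₂ : φ s ∈ S), d ⟨s, h₁⟩ = c ⟨φ s, h₂⟩) :
    rightLogDeriv d t ht = deriv φ t • rightLogDeriv c u hu' := by
  have hdt : d t = c u := by
    have := heq t htN t.2 (by rw [hu]; exact u.2)
    simp only [hu] at this
    exact this
  rw [rightLogDeriv_eq_velocity, rightLogDeriv_eq_velocity]
  refine velocity_reparam _ _ hN hφ t htN u hu ht hu' (fun s hs h₁ h₂ ↦ ?_) _ _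
  change d ⟨s, h₁⟩ * (d t)⁻¹ = c ⟨φ s, h₂⟩ * (c u)⁻¹
  rw [heq s hs h₁ h₂, hdt]

theorem rightLogDeriv_eq_zero_of_const {S : Set ℝ} (c : SmoothMap S G) (t : S)
    (ht : (t : ℝ) ∈ interior S) (hc : ∀ s, c s = c t) : rightLogDeriv c t ht = 0 := by
  rw [rightLogDeriv_eq_velocity]
  exact velocity_eq_zero_of_const _ t ht fun s ↦ by
    change c s * (c t)⁻¹ = 1
    rw [hc s, mul_inv_cancel]

theorem Ad_velocity {S : Set ℝ} (g : G) (c : SmoothMap S G) (t : S) (ht : (t : ℝ) ∈ interior S)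
    (hc : c t = 1) :
    Ad g (velocity c t ht hc) =
      velocity ⟨fun s ↦ g * c s * g⁻¹, (dSmooth_conj g).comp c.smooth⟩ t ht
        (show g * c t * g⁻¹ = 1 by simp [hc]) :=
  map_velocity c t ht hc _ _ _

theorem Ad_inv_Ad (g : G) (v : InternalTangentSpace (1 : G)) : Ad g⁻¹ (Ad g v) = v := by
  rw [Ad, Ad, InternalTangentSpace.map_map]
  exact InternalTangentSpace.map_eq_self _ _ (fun h ↦ by simp [mul_assoc]) v

/-- The right logarithmic derivative of the pointwise inverse. -/
theorem rightLogDeriv_inv {S : Set ℝ} (c : SmoothMap S G) (t : S) (ht : (t : ℝ) ∈ interior S) :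
    Ad (c t) (rightLogDeriv ⟨fun s ↦ (c s)⁻¹, c.smooth.inv⟩ t ht) = -rightLogDeriv c t ht := by
  let ci : SmoothMap S G := ⟨fun s ↦ (c s)⁻¹, c.smooth.inv⟩
  -- Differentiate the constant curve c·c⁻¹ = e. Varying the first factor gives δc; varying the
  -- second gives the Ad-image of δ(c⁻¹).
  have h := velocity_map₂ c ci (fun z ↦ z.1 * z.2) DiffeologicalGroup.smooth_mul t ht
    (z := 1) (mul_inv_cancel (c t))
  rw [velocity_eq_zero_of_const _ t ht (fun s ↦ mul_inv_cancel (c s))] at h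
  rw [eq_neg_iff_add_eq_zero, h, add_comm, rightLogDeriv_eq_velocity, rightLogDeriv_eq_velocity,
    Ad_velocity]
  congr 1
  refine velocity_congr (fun s ↦ ?_) t ht _ _
  change c t * ((c s)⁻¹ * (c t)⁻¹⁻¹) * (c t)⁻¹ = c t * (c s)⁻¹
  group

theorem mk_velocity {X : Type v} [DiffeologicalSpace X] {S : Set ℝ} (c : SmoothMap S X) (t : S)
    (ht : (t : ℝ) ∈ interior S) {x : X} (hc : c t = x) :
    (⟨x, velocity c t ht hc⟩ : InternalTangentBundle X) = ⟨c t, velocity c t ht rfl⟩ := by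
  subst hc
  rfl

theorem LocalPath.dSmooth_mk_time {X : Type v} [DiffeologicalSpace X] (c : LocalPath X) :
    DSmooth (fun t : c.dom ↦ (⟨(c, (t : ℝ)), t.2⟩ : TbLocalPath X)) := by
  refine DSmooth.subtype_mk (f := fun t : c.dom ↦ (c, (t : ℝ))) ?_ _
  exact DSmooth.prodMk dSmooth_const dSmooth_id.subtype_val

/-- The right logarithmic derivative of a local path. -/
def LocalPath.rightLogDeriv (c : LocalPath G) (t : c.dom) : InternalTangentSpace (1 : G) :=
  Diffeology.rightLogDeriv c.curve t (by rw [c.isOpen.interior_eq]; exact t.2)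

theorem LocalPath.dSmooth_rightLogDeriv :
    DSmooth (fun z : TbLocalPath G ↦ z.1.1.rightLogDeriv ⟨z.1.2, z.2⟩) := by
  -- The whole path is right-translated by the inverse of its value at the marked time. This is a
  -- smooth family, so smoothness of the velocity applies.
  let Φ : TbLocalPath G → LocalPath G := fun z ↦
    { z.1.1 with
      curve := ⟨fun s ↦ z.1.1.curve s * (z.1.1.curve ⟨z.1.2, z.2⟩)⁻¹,
        (dSmooth_mul_right _).comp z.1.1.curve.smooth⟩ }
  have hΦ : DSmooth Φ := by
    refine dSmooth_of_uncurry (dSmooth_id.subtype_val.fst) (fun z ↦ rfl) ?_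
    have h1 : DSmooth (fun w : {w : TbLocalPath G × ℝ // w.2 ∈ w.1.1.1.dom} ↦
        (⟨(w.1.1.1.1, w.1.2), w.2⟩ : TbLocalPath G)) :=
      (dSmooth_id.subtype_val.fst.subtype_val.fst.prodMk dSmooth_id.subtype_val.snd).subtype_mk _
    exact (dSmooth_eval.comp h1).group_mul (dSmooth_eval.comp dSmooth_id.subtype_val.fst).inv
  have h := dSmooth_velocity.comp
    ((hΦ.prodMk dSmooth_id.subtype_val.snd).subtype_mk (P := fun z ↦ z.2 ∈ z.1.dom) fun z ↦ z.2)
  intro n p hp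
  have hp' := h n p hp
  change IsPlot (fun a ↦ (⟨1, (p a).1.1.rightLogDeriv ⟨(p a).1.2, (p a).2⟩⟩ :
    InternalTangentBundle G))
  convert! hp' using 1
  funext a
  simp only [Function.comp, LocalPath.rightLogDeriv, rightLogDeriv_eq_velocity]
  exact mk_velocity _ _ _ _

theorem LocalPath.dSmooth_rightLogDeriv_curve (c : LocalPath G) :
    DSmooth (fun t : c.dom ↦ c.rightLogDeriv t) := by
  have h := LocalPath.dSmooth_rightLogDeriv.comp c.dSmooth_mk_time
  exact h

/-- Two smooth maps into `T_e G` that agree off one point agree. -/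
theorem IsDiffeologicalLieGroup.eq_of_eqOn_ne (hG : IsDiffeologicalLieGroup G) {S : Set ℝ}
    (hS : IsOpen S) {f g : S → InternalTangentSpace (1 : G)} (hf : DSmooth f) (hg : DSmooth g)
    (t : S) (h : ∀ s, s ≠ t → f s = g s) : f t = g t := by
  by_contra hcon
  -- A smooth functional separating the two values reduces the claim to continuity at `t` of a real
  -- function vanishing off `t`.
  obtain ⟨l, hl, hl0⟩ := hG.separating _ (sub_ne_zero.2 hcon)
  refine hl0 ?_
  classical
  let φ : ℝ → ℝ := fun s ↦ if h : s ∈ S then l (f ⟨s, h⟩) - l (g ⟨s, h⟩) else 0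
  have hφf : ∀ s : S, φ s = l (f s) - l (g s) := fun s ↦ by simp [φ]
  have hφ : ContinuousAt φ t :=
    (((hl.comp hf).sub (hl.comp hg)).contDiffOn_of_eq hS hφf).continuousOn.continuousAt
      (hS.mem_nhds t.2)
  have hzero : ∀ s, s ≠ (t : ℝ) → φ s = 0 := fun s hs ↦ by
    by_cases h' : s ∈ S
    · rw [hφf ⟨s, h'⟩, h ⟨s, h'⟩ (fun h ↦ hs (congrArg Subtype.val h)), sub_self]
    · simp [φ, h']
  have hlim : Filter.Tendsto φ (𝓝[≠] (t : ℝ)) (𝓝 0) :=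
    tendsto_const_nhds.congr' (Filter.eventually_of_mem self_mem_nhdsWithin
      fun s hs ↦ (hzero s hs).symm)
  have := tendsto_nhds_unique (hφ.tendsto.mono_left nhdsWithin_le_nhds) hlim
  rw [map_sub]
  exact (hφf t).symm.trans this

end LogDeriv

/-! ### Solving the logarithmic equation on an open interval. -/

section Evolution

/-- For a local path `ξ` in a tangent space, the path `s ↦ (t - t₀) • ξ(t₀ + s (t - t₀))` on
`[0,1]`. -/
def LocalPath.segment {X : Type u} [DiffeologicalSpace X] {x : X}
    (ξ : LocalPath (InternalTangentSpace x)) (t₀ t : ξ.dom) :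
    SmoothMap (Set.Icc (0 : ℝ) 1) (InternalTangentSpace x) :=
  ⟨fun s ↦ ((t : ℝ) - t₀) • ξ.curve ⟨t₀ + s * (t - t₀),
      ξ.ordConnected.convex.add_smul_sub_mem t₀.2 t.2 s.2⟩, by
    refine dSmooth_const.tangent_smul (ξ.curve.smooth.comp (DSmooth.subtype_mk ?_ _))
    exact dSmooth_const.add (dSmooth_id.subtype_val.mul dSmooth_const)⟩

/-- Joint smoothness in the path and both endpoints is what lets smoothness of `exp` yield smooth
dependence of the solution on all data. -/
theorem LocalPath.dSmooth_segment {X : Type u} [DiffeologicalSpace X] {x : X} :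
    DSmooth (fun w : {w : TbLocalPath (InternalTangentSpace x) × ℝ // w.2 ∈ w.1.1.1.dom} ↦
      w.1.1.1.1.segment ⟨w.1.1.1.2, w.1.1.2⟩ ⟨w.1.2, w.2⟩) := by
  refine SmoothMap.dSmooth_of_uncurry ?_
  have hw := dSmooth_fst (X := {w : TbLocalPath (InternalTangentSpace x) × ℝ // w.2 ∈ w.1.1.1.dom})
    (Y := Set.Icc (0 : ℝ) 1)
  have hs := (dSmooth_snd
    (X := {w : TbLocalPath (InternalTangentSpace x) × ℝ // w.2 ∈ w.1.1.1.dom})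
    (Y := Set.Icc (0 : ℝ) 1)).subtype_val
  have ht := hw.subtype_val.snd
  have ht₀ := hw.subtype_val.fst.subtype_val.snd
  refine (ht.sub ht₀).tangent_smul ?_
  exact LocalPath.dSmooth_eval.comp
    ((hw.subtype_val.fst.subtype_val.fst.prodMk (ht₀.add (hs.mul (ht.sub ht₀)))).subtype_mk
      (P := fun z ↦ z.2 ∈ z.1.dom)
      fun w ↦ w.1.1.1.1.1.ordConnected.convex.add_smul_sub_mem w.1.1.1.2 w.1.2 w.2.2)

variable {G : Type u} [Group G] [DiffeologicalSpace G]
  {exp : SmoothMap (Set.Icc (0 : ℝ) 1) (InternalTangentSpace (1 : G)) →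
      SmoothMap (Set.Icc (0 : ℝ) 1) G}

theorem LocalPath.dSmooth_exp_segment (hexp : DSmooth exp)
    (z : TbLocalPath (InternalTangentSpace (1 : G))) :
    DSmooth (fun t : z.1.1.dom ↦ exp (z.1.1.segment ⟨z.1.2, z.2⟩ t) ⟨1, by simp⟩) := by
  have h : DSmooth (fun t : z.1.1.dom ↦ (⟨(z, (t : ℝ)), t.2⟩ :
      {w : TbLocalPath (InternalTangentSpace (1 : G)) × ℝ // w.2 ∈ w.1.1.1.dom})) :=
    (dSmooth_const.prodMk dSmooth_id.subtype_val).subtype_mk _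
  have h' := hexp.comp (LocalPath.dSmooth_segment.comp h)
  exact (SmoothMap.dSmooth_eval _).comp h'

/-- The candidate solution of `h(t₀) = e`, `(R_{h(t)⁻¹})_* (dh/dt) = ξ(t)` on the domain of `ξ`. -/
def evolution (hexp : DSmooth exp) (z : TbLocalPath (InternalTangentSpace (1 : G))) :
    LocalPath G where
  dom := z.1.1.dom
  isOpen := z.1.1.isOpen
  ordConnected := z.1.1.ordConnected
  nonempty := z.1.1.nonempty
  curve := ⟨fun t ↦ exp (z.1.1.segment ⟨z.1.2, z.2⟩ t) ⟨1, by simp⟩,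
    LocalPath.dSmooth_exp_segment hexp z⟩

theorem dSmooth_evolution (hexp : DSmooth exp) : DSmooth (evolution hexp) :=
  LocalPath.dSmooth_of_uncurry (p := fun z : TbLocalPath (InternalTangentSpace (1 : G)) ↦ z.1.1)
    (Φ := evolution hexp) dSmooth_id.subtype_val.fst (fun _ ↦ rfl)
    ((SmoothMap.dSmooth_eval _).comp (hexp.comp LocalPath.dSmooth_segment))

variable [DiffeologicalGroup G]

/-- The affine map from [0,1] to the segment from `t₀` to `t` has derivative `t - t₀`, the factor
built into `segment`. This carries uniqueness on [0,1] over to intervals. -/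
theorem IsLogSolution.of_localPath {ξ : LocalPath (InternalTangentSpace (1 : G))}
    {h : SmoothMap ξ.dom G} {t₀ : ξ.dom} (h0 : h t₀ = 1)
    (hh : ∀ (t : ξ.dom) (ht : (t : ℝ) ∈ interior ξ.dom), rightLogDeriv h t ht = ξ.curve t)
    (t : ξ.dom) :
    IsLogSolution (ξ.segment t₀ t)
      ⟨fun s ↦ h ⟨t₀ + s * (t - t₀), ξ.ordConnected.convex.add_smul_sub_mem t₀.2 t.2 s.2⟩,
        h.smooth.comp (DSmooth.subtype_mk
          (dSmooth_const.add (dSmooth_id.subtype_val.mul dSmooth_const)) _)⟩ := by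
  constructor
  · simpa using h0
  · intro s hs
    have hd : HasDerivAt (fun s : ℝ ↦ (t₀ : ℝ) + s * (t - t₀)) ((t : ℝ) - t₀) s := by
      simpa using ((hasDerivAt_id (s : ℝ)).mul_const ((t : ℝ) - t₀)).const_add (t₀ : ℝ)
    have hmem : (t₀ : ℝ) + s * (t - t₀) ∈ ξ.dom :=
      ξ.ordConnected.convex.add_smul_sub_mem t₀.2 t.2 s.2
    rw [rightLogDeriv_reparam h _ (φ := fun s ↦ t₀ + s * (t - t₀)) isOpen_univ
      (ContDiff.contDiffOn (by fun_prop)) s trivial ⟨_, hmem⟩ rfl hs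
      (by rw [ξ.isOpen.interior_eq]; exact hmem) (fun _ _ _ _ ↦ rfl), hh, hd.deriv]
    rfl

theorem evolution_unique (hexp : DSmooth exp)
    (hsol : ∀ ξ, IsLogSolution ξ (exp ξ) ∧ ∀ g, IsLogSolution ξ g → g = exp ξ)
    {ξ : LocalPath (InternalTangentSpace (1 : G))} {t₀ : ℝ} (ht₀ : t₀ ∈ ξ.dom)
    {h : SmoothMap ξ.dom G} (h0 : h ⟨t₀, ht₀⟩ = 1)
    (hh : ∀ (t : ξ.dom) (ht : (t : ℝ) ∈ interior ξ.dom), rightLogDeriv h t ht = ξ.curve t) :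
    h = (evolution hexp ⟨(ξ, t₀), ht₀⟩).curve := by
  ext t
  change h t = exp (ξ.segment ⟨t₀, ht₀⟩ t) ⟨1, by simp⟩
  rw [← (hsol _).2 _ (IsLogSolution.of_localPath h0 hh t)]
  simp

/-- Slowing the solution down by the factor `s` gives the solution for the shortened segment, by
uniqueness. Hence the endpoint values defining `evolution` trace out a single exponential along each
segment. -/
theorem exp_segment_apply
    (hsol : ∀ ξ, IsLogSolution ξ (exp ξ) ∧ ∀ g, IsLogSolution ξ g → g = exp ξ)
    (ξ : LocalPath (InternalTangentSpace (1 : G))) (t₀ t : ξ.dom) (s : Set.Icc (0 : ℝ) 1) :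
    exp (ξ.segment t₀ t) s = exp (ξ.segment t₀ ⟨t₀ + s * (t - t₀),
      ξ.ordConnected.convex.add_smul_sub_mem t₀.2 t.2 s.2⟩) ⟨1, by simp⟩ := by
  have hmul : ∀ u : Set.Icc (0 : ℝ) 1, (s : ℝ) * u ∈ Set.Icc (0 : ℝ) 1 := fun u ↦
    ⟨mul_nonneg s.2.1 u.2.1, mul_le_one₀ s.2.2 u.2.1 u.2.2⟩
  let k : SmoothMap (Set.Icc (0 : ℝ) 1) G := ⟨fun u ↦ exp (ξ.segment t₀ t) ⟨s * u, hmul u⟩,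
    (exp (ξ.segment t₀ t)).smooth.comp
      (DSmooth.subtype_mk (dSmooth_const.mul dSmooth_id.subtype_val) _)⟩
  have hk : IsLogSolution (ξ.segment t₀ ⟨t₀ + s * (t - t₀),
      ξ.ordConnected.convex.add_smul_sub_mem t₀.2 t.2 s.2⟩) k := by
    constructor
    · simpa [k] using (hsol (ξ.segment t₀ t)).1.1
    · intro u hu
      -- For `s = 0` the time `s * u` is the endpoint 0, where no equation is available, but then
      -- the curve is constant and the shortened segment is zero.
      rcases s.2.1.eq_or_lt with hs | hs
      · rw [rightLogDeriv_eq_zero_of_const k u hu fun v ↦ by simp [k, ← hs]]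
        simp [LocalPath.segment, ← hs]
      · have hu' := hu
        rw [interior_Icc] at hu'
        have hmem : (s : ℝ) * u ∈ interior (Set.Icc (0 : ℝ) 1) := by
          rw [interior_Icc]
          exact ⟨mul_pos hs hu'.1, mul_lt_one_of_nonneg_of_lt_one_right s.2.2 u.2.1 hu'.2⟩
        have hd : HasDerivAt (fun u : ℝ ↦ (s : ℝ) * u) s u := by
          simpa using (hasDerivAt_id (u : ℝ)).const_mul (s : ℝ)
        rw [rightLogDeriv_reparam (exp (ξ.segment t₀ t)) k (φ := fun u ↦ s * u) isOpen_univ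
          (ContDiff.contDiffOn (by fun_prop)) u trivial ⟨_, hmul u⟩ rfl hu hmem
          (fun _ _ _ _ ↦ rfl), (hsol (ξ.segment t₀ t)).1.2, hd.deriv]
        simp only [LocalPath.segment, smul_smul]
        congr 1
        · ring
        · congr 2
          ring
  rw [← (hsol _).2 k hk]
  simp [k]

theorem evolution_apply_self (hexp : DSmooth exp)
    (hsol : ∀ ξ, IsLogSolution ξ (exp ξ) ∧ ∀ g, IsLogSolution ξ g → g = exp ξ)
    (ξ : LocalPath (InternalTangentSpace (1 : G))) {t₀ : ℝ} (ht₀ : t₀ ∈ ξ.dom) :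
    (evolution hexp ⟨(ξ, t₀), ht₀⟩).curve ⟨t₀, ht₀⟩ = 1 := by
  -- With `s = 0`, the degenerate exponential at time 1 equals its value at time 0, which is the
  -- identity.
  have := exp_segment_apply hsol ξ ⟨t₀, ht₀⟩ ⟨t₀, ht₀⟩ ⟨0, by simp⟩
  simp only [zero_mul, add_zero] at this
  exact this.symm.trans (hsol _).1.1

theorem rightLogDeriv_evolution_of_ne (hexp : DSmooth exp)
    (hsol : ∀ ξ, IsLogSolution ξ (exp ξ) ∧ ∀ g, IsLogSolution ξ g → g = exp ξ)
    (ξ : LocalPath (InternalTangentSpace (1 : G))) {t₀ : ℝ} (ht₀ : t₀ ∈ ξ.dom) (t : ξ.dom)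
    (hne : (t : ℝ) ≠ t₀) :
    (evolution hexp ⟨(ξ, t₀), ht₀⟩).rightLogDeriv t = ξ.curve t := by
  have hcts : Filter.Tendsto (fun r : ℝ ↦ t₀ + r * (t - t₀)) (𝓝[>] 1) (𝓝 (t : ℝ)) := by
    have : Continuous (fun r : ℝ ↦ t₀ + r * (t - t₀)) := by fun_prop
    simpa using (this.tendsto 1).mono_left nhdsWithin_le_nhds
  -- Prolong the segment past `t` by a factor `r > 1`, to the endpoint `T` below. Then `t` sits at
  -- the interior parameter `r⁻¹`, and the factor `T - t₀ ≠ 0` can be cancelled at the end.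
  obtain ⟨r, hr, hr1⟩ := ((hcts.eventually (ξ.isOpen.mem_nhds t.2)).and
    self_mem_nhdsWithin).exists
  have hr0 : (0 : ℝ) < r := lt_trans one_pos hr1
  have hri : r⁻¹ ∈ interior (Set.Icc (0 : ℝ) 1) := by
    rw [interior_Icc]
    exact ⟨inv_pos.2 hr0, inv_lt_one_of_one_lt₀ hr1⟩
  let T : ξ.dom := ⟨t₀ + r * (t - t₀), hr⟩
  have hT : (T : ℝ) - t₀ = r * (t - t₀) := by simp [T]
  have hT0 : (T : ℝ) - t₀ ≠ 0 := by
    rw [hT]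
    exact mul_ne_zero hr0.ne' (sub_ne_zero.2 hne)
  have htT : t₀ + r⁻¹ * ((T : ℝ) - t₀) = t := by
    rw [hT]
    field_simp
    ring
  have hd : HasDerivAt (fun s : ℝ ↦ t₀ + s * ((T : ℝ) - t₀)) ((T : ℝ) - t₀) r⁻¹ := by
    simpa using ((hasDerivAt_id (r⁻¹ : ℝ)).mul_const ((T : ℝ) - t₀)).const_add t₀
  have h1 := (hsol (ξ.segment ⟨t₀, ht₀⟩ T)).1.2 ⟨r⁻¹, interior_subset hri⟩ hri
  rw [rightLogDeriv_reparam (evolution hexp ⟨(ξ, t₀), ht₀⟩).curve _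
    (φ := fun s ↦ t₀ + s * (T - t₀)) isOpen_univ (ContDiff.contDiffOn (by fun_prop)) _ trivial t htT
    hri (by rw [LocalPath.isOpen _ |>.interior_eq]; exact t.2)
    (fun s _ h₁ h₂ ↦ exp_segment_apply hsol ξ ⟨t₀, ht₀⟩ T ⟨s, h₁⟩), hd.deriv] at h1
  refine smul_right_injective _ hT0 (h1.trans ?_)
  simp only [LocalPath.segment, htT]

/-- At `t = t₀` the parameter is an endpoint of every segment, so the equation there is obtained by
continuity from the other times. -/
theorem rightLogDeriv_evolution (hG : IsDiffeologicalLieGroup G) (hexp : DSmooth exp)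
    (hsol : ∀ ξ, IsLogSolution ξ (exp ξ) ∧ ∀ g, IsLogSolution ξ g → g = exp ξ)
    (ξ : LocalPath (InternalTangentSpace (1 : G))) {t₀ : ℝ} (ht₀ : t₀ ∈ ξ.dom) (t : ξ.dom) :
    (evolution hexp ⟨(ξ, t₀), ht₀⟩).rightLogDeriv t = ξ.curve t := by
  by_cases hne : (t : ℝ) = t₀
  · refine hG.eq_of_eqOn_ne ξ.isOpen
      (LocalPath.dSmooth_rightLogDeriv_curve (evolution hexp ⟨(ξ, t₀), ht₀⟩)) ξ.curve.smooth t
      fun s hs ↦ ?_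
    exact rightLogDeriv_evolution_of_ne hexp hsol ξ ht₀ s fun h ↦ hs (Subtype.ext (h.trans hne.symm))
  · exact rightLogDeriv_evolution_of_ne hexp hsol ξ ht₀ t hne

end Evolution

end Diffeology

end

/-! ### Horizontal gauge transforms and parallel transport. -/

noncomputable section

namespace Diffeology

universe u v w

/-- Preservation of fibres is hidden in local triviality: over the constant plot at `π y`, write `y
= k • q b`; then `g • y` is the component in `E` of `ψ (b, g * k)`, which lies in the pullback. -/
theorem IsPrincipalBundle.proj_smul {G : Type u} {E : Type v} {X : Type w} [Group G]
    [DiffeologicalSpace G] [DiffeologicalSpace E] [DiffeologicalSpace X] [MulAction G E]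
    [DiffeologicalAction G E] {π : E → X}
    (hπ : IsPrincipalBundle G π) (g : G) (y : E) : π (g • y) = π y := by
  obtain ⟨V, q, -, h0, -, -, ψ, ⟨-, χ, -, -, hχ⟩, hψ⟩ :=
    hπ.locally_trivial 0 (fun _ ↦ π y) isPlot_const 0
  set z : {z : V × E // π y = π z.2} := ⟨(⟨0, h0⟩, y), rfl⟩ with hz
  rcases hk : χ z with ⟨b, k⟩
  have h1 : ψ (b, k) = z := by rw [← hk, hχ]
  have h2 : y = k • q b := by
    have := congrArg (fun z : {z : V × E // π y = π z.2} ↦ z.1.2) h1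
    simpa [hψ, hz] using this.symm
  have h3 := (ψ (b, g * k)).2
  rw [hψ, mul_smul, ← h2] at h3
  exact h3.symm

section Connection

variable {G : Type u} {E : Type v} [Group G] [DiffeologicalSpace G] [DiffeologicalGroup G]
  [DiffeologicalSpace E] [MulAction G E] [DiffeologicalAction G E]

namespace ConnectionForm

/-- The local path `t ↦ ω(dγ/dt)` in `T_e G`. -/
def logPath (ω : ConnectionForm G E) (γ : LocalPath E) :
    LocalPath (InternalTangentSpace (1 : G)) where
  dom := γ.dom
  isOpen := γ.isOpen
  ordConnected := γ.ordConnected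
  nonempty := γ.nonempty
  curve := ⟨fun t ↦ ω.form (γ.curve t) (γ.velocity t), by
    have h := ω.smooth.comp (LocalPath.dSmooth_velocity.comp γ.dSmooth_mk_time)
    exact h⟩

theorem dSmooth_logPath (ω : ConnectionForm G E) : DSmooth ω.logPath := by
  refine LocalPath.dSmooth_of_uncurry dSmooth_id (fun _ ↦ rfl) ?_
  have h := ω.smooth.comp (LocalPath.dSmooth_velocity (X := E))
  exact h

/-- A curve in the orbit of `y` has the right logarithmic derivative as its vertical part. -/
theorem form_velocity_smul (ω : ConnectionForm G E) {S : Set ℝ} (hS : IsOpen S)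
    (hS' : S.OrdConnected) (g : SmoothMap S G) (y : E) (t : S) (ht : (t : ℝ) ∈ interior S) :
    ω.form (g t • y) (velocity ⟨fun s ↦ g s • y,
      DiffeologicalAction.smooth_smul.comp (g.smooth.prodMk dSmooth_const)⟩ t ht rfl) =
      rightLogDeriv g t ht := by
  -- The vertical axiom concerns curves through `e` at time 0, so it is applied to s ↦ g(t+s)g(t)⁻¹
  -- acting on the point `g t • y`; the shift of time has derivative 1.
  let c : LocalPath G :=
    { dom := {s | (t : ℝ) + s ∈ S}
      isOpen := hS.preimage (by fun_prop)
      ordConnected := hS'.preimage_mono fun a b hab ↦ by simpa using hab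
      nonempty := ⟨0, by simp⟩
      curve := ⟨fun s ↦ g ⟨t + s, s.2⟩ * (g t)⁻¹, by
        refine (dSmooth_mul_right _).comp (g.smooth.comp (DSmooth.subtype_mk ?_ _))
        exact dSmooth_const.add dSmooth_id.subtype_val⟩ }
  have h0 : (0 : ℝ) ∈ c.dom := by simp [c]
  have h1 : c.curve ⟨0, h0⟩ = 1 := by simp [c]
  have hφ : deriv (fun s : ℝ ↦ s - t) t = 1 := by simp
  have hint : ∀ d : LocalPath G, ∀ s : d.dom, (s : ℝ) ∈ interior d.dom := fun d s ↦ by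
    rw [d.isOpen.interior_eq]; exact s.2
  have hv := ω.vertical (g t • y) c h0 h1
  rw [rightLogDeriv_eq_velocity,
    velocity_reparam c.curve _ (φ := fun s ↦ s - t) isOpen_univ
      (ContDiff.contDiffOn (by fun_prop)) t trivial ⟨0, h0⟩ (sub_self _) ht (hint c ⟨0, h0⟩)
      (fun s _ h₁ h₂ ↦ by simp [c]) _ h1,
    velocity_reparam (c.orbit (g t • y)).curve _ (φ := fun s ↦ s - t) isOpen_univ
      (ContDiff.contDiffOn (by fun_prop)) t trivial ⟨0, h0⟩ (sub_self _) ht (hint c ⟨0, h0⟩)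
      (fun s _ h₁ h₂ ↦ by simp [c, LocalPath.orbit, smul_smul]) _
      (show c.curve ⟨0, h0⟩ • g t • y = g t • y by rw [h1, one_smul]),
    hφ, one_smul]
  exact hv.trans (one_smul ℝ _).symm

/-- Leibniz rule: the part where `γ` varies is handled by equivariance, the part where `g` varies by
`form_velocity_smul`. -/
theorem form_velocity_gauge (ω : ConnectionForm G E) (γ : LocalPath E) (g : SmoothMap γ.dom G)
    (t : γ.dom) (ht : (t : ℝ) ∈ interior γ.dom) :
    ω.form ((γ.gauge g).curve t) ((γ.gauge g).velocity t) =
      Ad (g t) (ω.form (γ.curve t) (γ.velocity t)) + rightLogDeriv g t ht := by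
  have h := velocity_map₂ g γ.curve (fun z : G × E ↦ z.1 • z.2) DiffeologicalAction.smooth_smul
    t ht rfl
  have h2 := map_velocity γ.curve t ht rfl (fun y ↦ g t • y) (dSmooth_smul (g t)) rfl
  calc ω.form ((γ.gauge g).curve t) ((γ.gauge g).velocity t)
      = ω.form (g t • γ.curve t) (velocity ⟨fun s ↦ g s • γ.curve s,
          DiffeologicalAction.smooth_smul.comp (g.smooth.prodMk γ.curve.smooth)⟩ t ht rfl) := rfl
    _ = _ := by
      rw [h, map_add, ω.form_velocity_smul γ.isOpen γ.ordConnected, add_comm]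
      congr 1
      rw [← ω.equivariant]
      exact congrArg _ h2.symm

/-- Passing to g⁻¹ removes the unknown from the right-hand side, leaving the equation that
regularity solves. -/
theorem isHorizontal_gauge_iff (ω : ConnectionForm G E) (γ : LocalPath E)
    (g : SmoothMap γ.dom G) :
    ω.IsHorizontal (γ.gauge g) ↔ ∀ (t : γ.dom) (ht : (t : ℝ) ∈ interior γ.dom),
      rightLogDeriv ⟨fun s ↦ (g s)⁻¹, g.smooth.inv⟩ t ht = (ω.logPath γ).curve t := by
  have hint : ∀ t : γ.dom, (t : ℝ) ∈ interior γ.dom := fun t ↦ by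
    rw [γ.isOpen.interior_eq]; exact t.2
  have key : ∀ (t : γ.dom) (ht : (t : ℝ) ∈ interior γ.dom),
      ω.form ((γ.gauge g).curve t) ((γ.gauge g).velocity t) = 0 ↔
        rightLogDeriv ⟨fun s ↦ (g s)⁻¹, g.smooth.inv⟩ t ht = (ω.logPath γ).curve t := by
    intro t ht
    rw [form_velocity_gauge ω γ g t ht, ← neg_neg (rightLogDeriv g t ht), ← rightLogDeriv_inv,
      ← sub_eq_add_neg, sub_eq_zero]
    exact ⟨fun h ↦ ((Function.LeftInverse.injective (Ad_inv_Ad (g t))) h).symm,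
      fun h ↦ congrArg _ h.symm⟩
  exact ⟨fun h t ht ↦ (key t ht).1 (h t), fun h t ↦ (key t (hint t)).2 (h t (hint t))⟩

theorem IsHorizontal.form_velocity_eq {ω : ConnectionForm G E} {γ : LocalPath E}
    {g : SmoothMap γ.dom G} (h : ω.IsHorizontal (γ.gauge g)) (t : γ.dom)
    (ht : (t : ℝ) ∈ interior γ.dom) :
    ω.form (γ.curve t) (γ.velocity t) = -Ad (g t)⁻¹ (rightLogDeriv g t ht) := by
  have h0 := (form_velocity_gauge ω γ g t ht).symm.trans (h t)
  rw [← neg_eq_iff_add_eq_zero] at h0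
  rw [← h0, map_neg, neg_neg, Ad_inv_Ad]

theorem IsHorizontal.smul {ω : ConnectionForm G E} {γ : LocalPath E} (h : ω.IsHorizontal γ)
    (a : G) : ω.IsHorizontal (γ.smul a) := by
  intro (t : γ.dom)
  have ht : (t : ℝ) ∈ interior γ.dom := by rw [γ.isOpen.interior_eq]; exact t.2
  refine (form_velocity_gauge ω γ ⟨fun _ ↦ a, dSmooth_const⟩ t ht).trans ?_
  rw [h t, map_zero, rightLogDeriv_eq_zero_of_const _ _ _ fun _ ↦ rfl, add_zero]

theorem IsHorizontal.comp {ω : ConnectionForm G E} {γ : LocalPath E} (h : ω.IsHorizontal γ)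
    (f : LocalPath ℝ) (hf : ∀ t, f.curve t ∈ γ.dom) : ω.IsHorizontal (γ.comp f hf) := by
  intro t
  classical
  -- The chain rule needs a function on ℝ; the values off `f.dom` are irrelevant.
  let φ : ℝ → ℝ := fun s ↦ if hs : s ∈ f.dom then f.curve ⟨s, hs⟩ else 0
  have hφf : ∀ s : f.dom, φ s = f.curve s := fun s ↦ by simp [φ]
  have hv := velocity_reparam γ.curve (γ.comp f hf).curve (φ := φ) f.isOpen
    (f.curve.smooth.contDiffOn_of_eq f.isOpen hφf) t t.2 ⟨f.curve t, hf t⟩ (hφf t)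
    (by rw [(γ.comp f hf).isOpen.interior_eq]; exact t.2)
    (by rw [γ.isOpen.interior_eq]; exact hf t)
    (fun s hs h₁ h₂ ↦ congrArg γ.curve (Subtype.ext (hφf ⟨s, hs⟩).symm)) rfl rfl
  refine (congrArg _ hv).trans ?_
  rw [map_smul]
  have h0 := h ⟨f.curve t, hf t⟩
  exact (congrArg _ h0).trans (smul_zero _)

end ConnectionForm

/-- Parallel transport: the horizontal gauge transform of `γ` that fixes `γ(t₀)`. -/
def parallelTransport {exp : SmoothMap (Set.Icc (0 : ℝ) 1) (InternalTangentSpace (1 : G)) →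
      SmoothMap (Set.Icc (0 : ℝ) 1) G} (hexp : DSmooth exp) (ω : ConnectionForm G E)
    (z : TbLocalPath E) : LocalPath E :=
  z.1.1.gauge ⟨fun t ↦ ((evolution hexp ⟨(ω.logPath z.1.1, z.1.2), z.2⟩).curve t)⁻¹,
    (evolution hexp ⟨(ω.logPath z.1.1, z.1.2), z.2⟩).curve.smooth.inv⟩

section

variable {exp : SmoothMap (Set.Icc (0 : ℝ) 1) (InternalTangentSpace (1 : G)) →
  SmoothMap (Set.Icc (0 : ℝ) 1) G}

theorem dSmooth_parallelTransport (hexp : DSmooth exp) (ω : ConnectionForm G E) :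
    DSmooth (parallelTransport hexp ω) := by
  refine LocalPath.dSmooth_of_uncurry (p := fun z : TbLocalPath E ↦ z.1.1)
    dSmooth_id.subtype_val.fst (fun _ ↦ rfl) ?_
  have hη : DSmooth (fun z : TbLocalPath E ↦
      evolution hexp ⟨(ω.logPath z.1.1, z.1.2), z.2⟩) := by
    have h : DSmooth (fun z : TbLocalPath E ↦ (⟨(ω.logPath z.1.1, z.1.2), z.2⟩ :
        TbLocalPath (InternalTangentSpace (1 : G)))) := by
      refine DSmooth.subtype_mk (f := fun z : TbLocalPath E ↦ (ω.logPath z.1.1, z.1.2)) ?_ _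
      exact (ω.dSmooth_logPath.comp dSmooth_id.subtype_val.fst).prodMk dSmooth_id.subtype_val.snd
    exact (dSmooth_evolution hexp).comp h
  let K := {w : TbLocalPath E × ℝ // w.2 ∈ w.1.1.1.dom}
  have hz : DSmooth (fun w : K ↦ w.1.1) := dSmooth_id.subtype_val.fst
  have ht : DSmooth (fun w : K ↦ w.1.2) := dSmooth_id.subtype_val.snd
  have h1 : DSmooth (fun w : K ↦ (⟨(w.1.1.1.1, w.1.2), w.2⟩ : TbLocalPath E)) := by
    refine DSmooth.subtype_mk (f := fun w : K ↦ (w.1.1.1.1, w.1.2)) ?_ _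
    exact hz.subtype_val.fst.prodMk ht
  have h2 : DSmooth (fun w : K ↦
      (⟨(evolution hexp ⟨(ω.logPath w.1.1.1.1, w.1.1.1.2), w.1.1.2⟩, w.1.2), w.2⟩ :
        TbLocalPath G)) := by
    refine DSmooth.subtype_mk (f := fun w : K ↦
      (evolution hexp ⟨(ω.logPath w.1.1.1.1, w.1.1.1.2), w.1.1.2⟩, w.1.2)) ?_ _
    exact (hη.comp hz).prodMk ht
  exact (LocalPath.dSmooth_eval.comp h2).inv.action_smul (LocalPath.dSmooth_eval.comp h1)

/-- Inversion is a bijection between horizontal gauge transforms equal to `e` at `t₀` and solutions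
of the logarithmic equation, so existence and uniqueness transfer from `evolution`. -/
theorem parallelTransport_spec (hG : IsDiffeologicalLieGroup G) (hexp : DSmooth exp)
    (hsol : ∀ ξ, IsLogSolution ξ (exp ξ) ∧ ∀ g, IsLogSolution ξ g → g = exp ξ)
    (ω : ConnectionForm G E) (γ : LocalPath E) {t₀ : ℝ} (h : t₀ ∈ γ.dom) :
    ∃ g : SmoothMap γ.dom G, parallelTransport hexp ω ⟨(γ, t₀), h⟩ = γ.gauge g ∧
      g ⟨t₀, h⟩ = 1 ∧ ω.IsHorizontal (γ.gauge g) ∧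
      ∀ g' : SmoothMap γ.dom G, g' ⟨t₀, h⟩ = 1 → ω.IsHorizontal (γ.gauge g') → g' = g := by
  refine ⟨_, rfl, ?_, ?_, ?_⟩
  · exact inv_eq_one.2 (evolution_apply_self hexp hsol (ω.logPath γ) h)
  · rw [ω.isHorizontal_gauge_iff]
    intro t ht
    simp only [inv_inv]
    exact rightLogDeriv_evolution hG hexp hsol (ω.logPath γ) h t
  · intro g' h1 hg'
    rw [ω.isHorizontal_gauge_iff] at hg'
    have := evolution_unique hexp hsol (ξ := ω.logPath γ) h
      (h := ⟨fun s ↦ (g' s)⁻¹, g'.smooth.inv⟩) (inv_eq_one.2 h1) hg'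
    ext t
    change g' t = ((evolution hexp ⟨(ω.logPath γ, t₀), h⟩).curve t)⁻¹
    rw [← this, inv_inv]

theorem isDiffeologicalConnection_parallelTransport {X : Type w} [DiffeologicalSpace X]
    {π : E → X} (hπ : IsPrincipalBundle G π)
    (hG : IsDiffeologicalLieGroup G) (hexp : DSmooth exp)
    (hsol : ∀ ξ, IsLogSolution ξ (exp ξ) ∧ ∀ g, IsLogSolution ξ g → g = exp ξ)
    (ω : ConnectionForm G E) :
    IsDiffeologicalConnection G π (parallelTransport hexp ω) := by
  -- The last three axioms are checked by naming a horizontal gauge transform with value `e` at the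
  -- initial time: a·g·a⁻¹ for translation by `a`, g∘f for reparametrisation, the constant `e` for
  -- idempotence.
  have huniq : ∀ (γ : LocalPath E) (t₀ : ℝ) (h : t₀ ∈ γ.dom) (g : SmoothMap γ.dom G),
      g ⟨t₀, h⟩ = 1 → ω.IsHorizontal (γ.gauge g) →
        parallelTransport hexp ω ⟨(γ, t₀), h⟩ = γ.gauge g := by
    intro γ t₀ h g h1 hg
    obtain ⟨g₀, h₀, -, -, hu⟩ := parallelTransport_spec hG hexp hsol ω γ h
    rw [h₀, hu g h1 hg]
  have hself : ∀ (γ : LocalPath E) (t₀ : ℝ) (h : t₀ ∈ γ.dom), ω.IsHorizontal γ →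
      parallelTransport hexp ω ⟨(γ, t₀), h⟩ = γ := by
    intro γ t₀ h hγ
    have hone : γ.gauge (⟨fun _ ↦ 1, dSmooth_const⟩ : SmoothMap γ.dom G) = γ :=
      LocalPath.ext_of_eqOn rfl fun t h₁ h₂ ↦ one_smul G _
    rw [huniq γ t₀ h ⟨fun _ ↦ 1, dSmooth_const⟩ rfl (by rw [hone]; exact hγ), hone]
  refine
    { smooth := dSmooth_parallelTransport hexp ω
      dom_eq := fun _ _ _ ↦ rfl
      proj_eq := fun γ t₀ h t ↦ hπ.proj_smul _ _
      apply_self := fun γ t₀ h ↦ ?_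
      smul := fun a γ t₀ h ↦ ?_
      comp := fun γ f hf s ↦ ?_
      idem := fun γ t₀ h ↦ ?_ }
  · change ((evolution hexp ⟨(ω.logPath γ, t₀), h⟩).curve ⟨t₀, h⟩)⁻¹ • γ.curve ⟨t₀, h⟩ = _
    have := evolution_apply_self hexp hsol (ω.logPath γ) h
    exact (congrArg (fun k : G ↦ k⁻¹ • γ.curve ⟨t₀, h⟩) this).trans (by simp)
  · obtain ⟨g, hg, h1, hhor, -⟩ := parallelTransport_spec hG hexp hsol ω γ h
    -- Conjugation is forced because the structure group acts on the left: (a g a⁻¹)·(a·γ) =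
    -- a·(g·γ).
    have hconj : (LocalPath.smul a γ).gauge ⟨fun t ↦ a * g t * a⁻¹, (dSmooth_conj a).comp g.smooth⟩ =
        LocalPath.smul a (γ.gauge g) :=
      LocalPath.ext_of_eqOn rfl fun t h₁ h₂ ↦ by
        change (a * g ⟨t, h₁⟩ * a⁻¹) • a • γ.curve ⟨t, h₁⟩ = a • g ⟨t, h₁⟩ • γ.curve ⟨t, h₁⟩
        simp [smul_smul]
    rw [hg, ← hconj]
    refine huniq _ _ _ _ ?_ (by rw [hconj]; exact hhor.smul a)
    change a * g ⟨t₀, h⟩ * a⁻¹ = 1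
    simp [h1]
  · obtain ⟨g, hg, h1, hhor, -⟩ := parallelTransport_spec hG hexp hsol ω γ (hf s)
    have h2 : parallelTransport hexp ω ⟨(γ.comp f hf, s), s.2⟩ = (γ.gauge g).comp f hf :=
      huniq (γ.comp f hf) s s.2 ⟨fun t ↦ g ⟨f.curve t, hf t⟩,
        g.smooth.comp (f.curve.smooth.subtype_mk hf)⟩ h1 (hhor.comp f hf)
    have hcomp : ∀ (δ δ' : LocalPath E) (_ : δ = δ') (hδ : ∀ t, f.curve t ∈ δ.dom)
        (hδ' : ∀ t, f.curve t ∈ δ'.dom), δ.comp f hδ = δ'.comp f hδ' := by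
      rintro δ _ rfl _ _
      rfl
    exact h2.trans (hcomp _ _ hg.symm _ _)
  · obtain ⟨g, hg, -, hhor, -⟩ := parallelTransport_spec hG hexp hsol ω γ h
    exact hself _ _ _ (by rw [hg]; exact hhor)

end

end Connection

end Diffeology

end

theorem propositionp {G : Type*} {E : Type*} {X : Type*}
    [Group G] [DiffeologicalSpace G] [DiffeologicalGroup G]
    [DiffeologicalSpace E] [DiffeologicalSpace X] [MulAction G E] [DiffeologicalAction G E]
    (hG : IsRegularLieGroup G) (π : E → X) (hπ : IsPrincipalBundle G π)
    (ω : ConnectionForm G E) :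
    ∃ θ : TbLocalPath E → LocalPath E, IsDiffeologicalConnection G π θ ∧
      ∀ (γ : LocalPath E) (t₀ : ℝ) (h : t₀ ∈ γ.dom), ∃ g : SmoothMap γ.dom G,
        θ ⟨(γ, t₀), h⟩ = γ.gauge g ∧
        g ⟨t₀, h⟩ = 1 ∧
        ω.IsHorizontal (γ.gauge g) ∧
        (∀ (t : γ.dom) (ht : (t : ℝ) ∈ interior γ.dom),
          ω.form (γ.curve t) (γ.velocity t) = -Ad (g t)⁻¹ (rightLogDeriv g t ht)) ∧
        ∀ g' : SmoothMap γ.dom G, g' ⟨t₀, h⟩ = 1 → ω.IsHorizontal (γ.gauge g') → g' = g := by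
  obtain ⟨exp, hexp, hsol⟩ := hG.exists_exp
  refine ⟨parallelTransport hexp ω,
    isDiffeologicalConnection_parallelTransport hπ hG.isLie hexp hsol ω, fun γ t₀ h ↦ ?_⟩
  obtain ⟨g, h1, h2, h3, h4⟩ := parallelTransport_spec hG.isLie hexp hsol ω γ h
  exact ⟨g, h1, h2, h3, h3.form_velocity_eq, h4⟩
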